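/- Let $W=W_{-1}\oplus W_0\oplus W_1$ be the $\mathbb Z$-graded complex vector space with basis $e_1,e_2,e_3$ of degrees $|e_1|=0$, $|e_2|=-1$, $|e_3|=1$, and let $S(W)$ be its graded symmetric coalgebra. A codifferential is a coderivation $d$ of $S(W)$ of degree $1$ with $d^2=0$, having components $S^r(W)\to W$ only for $r\ge 1$ (that is, $d(1)=0$). Codifferentials $d,d'$ are equivalent, $d\sim d'$, if $d'=g^{-1}dg$ for some degree-$0$ coalgebra automorphism $g$ of $S(W)$; they are linearly equivalent if $g$ can be chosen with $g(w_1\cdots w_n)=g(w_1)\cdots g(w_n)$. For $m\in\{1,3\}$ let $\psi^{i_1i_2i_3}_m$ be the coderivation whose component $S^{i_1+i_2+i_3}(W)\to W$ sends $e_1^{i_1}e_2^{i_2}e_3^{i_3}$ to $i_1!\,i_2!\,i_3!\,e_m$ and every other monomial to $0$, and whose other components vanish. Put $$\begin{array}{lcll} d_k(\lambda:\mu)&=&\psi^{k-1,1,0}_1\lambda+\psi^{k-2,1,1}_3\mu, & (\lambda:\mu)\in\mathbb P^1(\mathbb C),\ k\ge 2,\\ d_1(1:0)&=&\psi^{0,1,0}_1\lambda,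 & \lambda\neq 0,\\ d_k^*&=&\psi^{k,0,0}_3, & k\ge1,\\ d_{k,l}(\alpha)&=&\psi^{k-2,1,1}_3+\psi^{l-1,1,0}_1+\psi^{2l-k-1,1,0}_1\alpha, & 2\le k<l,\ \alpha\in\mathbb C,\\ d^\sharp_{k,l}&=&\psi^{k-1,1,0}_1+\psi^{k-2,1,1}_3\,l+\psi^{l,0,0}_3, & 2\le k\le l, \end{array}$$ where any choice of homogeneous coordinates $(\lambda,\mu)$ may be used for $d_k(\lambda:\mu)$ (and any $\lambda\ne0$ for $d_1(1:0)$). (1) All of these are nonzero codifferentials. (2) Every nonzero codifferential on $S(W)$ (that is, every nonzero $\mathbb Z$-graded $L_\infty$ structure on a space of type $(-1,0,1)$) is equivalent to exactly one member of the list: $d_k(\lambda:\mu)$ with $(\lambda:\mu)\in\mathbb P^1(\mathbb C)$ (only $(1:0)$ if $k=1$); $d_k^*$; $d_{k,l}(\alpha)$; or $d^\sharp_{k,l}$. Different choices of homogeneous coordinates of one point give equivalent codifferentials. (3) Every nonzero codifferential all of whose components $S^r(W)\to W$ with $r\ne k$ vanish is linearly equivalent to exactly one of $d_k(\lambda:\mu)$,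 $d_k^*$, $d_k^\sharp:=d^\sharp_{k,k}$. (4) Let $d_0$ be one of $d_k(\lambda:\mu)$, $d_k^*$, $d_k^\sharp$. An extension of $d_0$ is a codifferential whose components $S^r(W)\to W$ agree with those of $d_0$ for all $r\le k$. Up to equivalence, the extensions of $d_0$ are $d_0$ itself and: if $d_0=d_k(0:1)$, also all $d_{k,l}(\alpha)$ with $l>k$ and $\alpha\in\mathbb C$; if $d_0=d_k(1:l)$ with $k\ge2$ and an integer $l>k$, also $d^\sharp_{k,l}$. In particular, extensions not equivalent to $d_0$ occur only for $d_k(0:1)$ and for $d_k(1:l)$ with $l>k\ge 2$. -/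

import Mathlib

open scoped TensorProduct LinearAlgebra.Projectivization

namespace LInf

/-- Exponents `(i₁, i₂, i₃)` of the monomials `e₁^i₁ e₂^i₂ e₃^i₃` forming a basis of `S(W)`, where
`W` has basis `e₁, e₂, e₃` of degrees `0, -1, 1`.  The generators `e₂, e₃` are odd, hence
square to zero in the graded symmetric algebra. -/
abbrev Mono : Type := ℕ × Fin 2 × Fin 2

/-- The (integer) degree of a monomial. -/
def Mono.deg (m : Mono) : ℤ := (m.2.2 : ℕ) - (m.2.1 : ℕ)

/-- The number `r` of factors of a monomial, so that it lies in `S^r(W)`. -/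
def Mono.weight (m : Mono) : ℕ := m.1 + m.2.1 + m.2.2

/-- The graded symmetric coalgebra `S(W)` over `ℂ` of `W = W₋₁ ⊕ W₀ ⊕ W₁`,
with its monomial basis. It includes the unit, i.e. `S^0(W) = ℂ`. -/
def S : Type := Mono →₀ ℂ

noncomputable instance : AddCommGroup S := inferInstanceAs (AddCommGroup (Mono →₀ ℂ))

noncomputable instance : Module ℂ S := inferInstanceAs (Module ℂ (Mono →₀ ℂ))

/-- The monomial `e₁^i₁ e₂^i₂ e₃^i₃`. -/
noncomputable def mon (m : Mono) : S := Finsupp.single m (1 : ℂ)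

/-- The linear map on `S(W)` with prescribed values on monomials. -/
noncomputable def onMon {M : Type} [AddCommGroup M] [Module ℂ M] (f : Mono → M) : S →ₗ[ℂ] M :=
  Finsupp.linearCombination ℂ f

lemma onMon_mon {M : Type} [AddCommGroup M] [Module ℂ M] (f : Mono → M) (m : Mono) :
    onMon f (mon m) = f m := by
  unfold onMon mon
  exact (Finsupp.linearCombination_single ℂ (1 : ℂ) m).trans (one_smul ℂ (f m))

lemma S_hom_ext {M : Type} [AddCommGroup M] [Module ℂ M] {f g : S →ₗ[ℂ] M}
    (h : ∀ m, f (mon m) = g (mon m)) : f = g :=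
  Finsupp.lhom_ext' fun m => LinearMap.ext_ring (h m)

/-- The two-part decompositions of an exponent in `{0, 1}`. -/
def split (j : Fin 2) : Finset (Fin 2 × Fin 2) :=
  Finset.univ.filter fun p => (p.1 : ℕ) + (p.2 : ℕ) = (j : ℕ)

/-- The coproduct: `Δ(e^m) = ∑_{a + b = m} C(m₁, a₁) (-1)^(a₃ b₂) e^a ⊗ e^b`, the sum over
unshuffles, the Koszul sign arising from moving `e₃^a₃` past `e₂^b₂`. -/
noncomputable def comulMon (m : Mono) : S ⊗[ℂ] S :=
  ∑ n ∈ Finset.HasAntidiagonal.antidiagonal m.1, ∑ j ∈ split m.2.1, ∑ k ∈ split m.2.2,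
    ((m.1.choose n.1 : ℂ) * (-1) ^ ((k.1 : ℕ) * (j.2 : ℕ))) •
      (mon (n.1, j.1, k.1) ⊗ₜ[ℂ] mon (n.2, j.2, k.2))

noncomputable instance : CoalgebraStruct ℂ S where
  comul := onMon comulMon
  counit := onMon fun m => if m = (0, 0, 0) then 1 else 0

lemma choose_antidiagonal_assoc {M : Type} [AddCommGroup M] [Module ℂ M]
    (F : ℕ → ℕ → ℕ → M) (n : ℕ) :
    ∑ p ∈ Finset.HasAntidiagonal.antidiagonal n, ∑ q ∈ Finset.HasAntidiagonal.antidiagonal p.1,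
      ((n.choose p.1 : ℂ) * (p.1.choose q.1 : ℂ)) • F q.1 q.2 p.2 =
    ∑ p ∈ Finset.HasAntidiagonal.antidiagonal n, ∑ q ∈ Finset.HasAntidiagonal.antidiagonal p.2,
      ((n.choose p.1 : ℂ) * (p.2.choose q.1 : ℂ)) • F p.1 q.1 q.2 := by
  rw [Finset.sum_sigma', Finset.sum_sigma']
  refine Finset.sum_nbij' (fun x => ⟨(x.2.1, x.2.2 + x.1.2), (x.2.2, x.1.2)⟩)
    (fun x => ⟨(x.1.1 + x.2.1, x.2.2), (x.1.1, x.2.1)⟩) ?_ ?_ ?_ ?_ ?_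
  · rintro ⟨⟨a, b⟩, ⟨c, d⟩⟩ h
    simp only [Finset.mem_sigma, Finset.HasAntidiagonal.mem_antidiagonal] at h ⊢
    grind
  · rintro ⟨⟨a, b⟩, ⟨c, d⟩⟩ h
    simp only [Finset.mem_sigma, Finset.HasAntidiagonal.mem_antidiagonal] at h ⊢
    grind
  · rintro ⟨⟨a, b⟩, ⟨c, d⟩⟩ h
    simp only [Finset.mem_sigma, Finset.HasAntidiagonal.mem_antidiagonal] at h
    obtain ⟨h1, h2⟩ := h
    subst h2
    rfl
  · rintro ⟨⟨a, b⟩, ⟨c, d⟩⟩ h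
    simp only [Finset.mem_sigma, Finset.HasAntidiagonal.mem_antidiagonal] at h
    obtain ⟨h1, h2⟩ := h
    subst h2
    rfl
  · rintro ⟨⟨a, b⟩, ⟨c, d⟩⟩ h
    simp only [Finset.mem_sigma, Finset.HasAntidiagonal.mem_antidiagonal] at h
    obtain ⟨h1, h2⟩ := h
    subst h2
    subst h1
    have key : (c + d + b).choose (c + d) * (c + d).choose c =
        (c + d + b).choose c * (d + b).choose d := by
      have h := Nat.choose_mul (n := c + d + b) (k := c + d) (s := c) 
      rw [h (by omega)]
      congr 2 <;> omega
    congr 1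
    exact_mod_cast key

lemma split_zero : split 0 = {(0, 0)} := by decide

lemma split_one : split 1 = {(0, 1), (1, 0)} := by decide

lemma comul_mon (m : Mono) : Coalgebra.comul (R := ℂ) (mon m) = comulMon m := onMon_mon _ m

lemma counit_mon (m : Mono) :
    Coalgebra.counit (R := ℂ) (mon m) = if m = (0, 0, 0) then (1 : ℂ) else 0 := onMon_mon _ m

noncomputable instance : Coalgebra ℂ S where
  coassoc := by
    refine S_hom_ext ?_
    rintro ⟨n, j, k⟩
    have H := fun j₁ j₂ j₃ k₁ k₂ k₃ : Fin 2 => choose_antidiagonal_assoc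
      (fun a b c => mon (a, j₁, k₁) ⊗ₜ[ℂ] (mon (b, j₂, k₂) ⊗ₜ[ℂ] mon (c, j₃, k₃))) n
    simp only [LinearMap.comp_apply, LinearEquiv.coe_coe, comul_mon]
    fin_cases j <;> fin_cases k <;>
    · simp only [comulMon, split_zero, split_one, Fin.mk_one, Fin.zero_eta, Finset.sum_singleton,
        Finset.sum_pair (show ((0 : Fin 2), (1 : Fin 2)) ≠ (1, 0) by decide), Fin.val_zero,
        Fin.val_one, mul_zero, zero_mul, mul_one, pow_zero, pow_one, map_sum, map_add, map_smul,
        LinearMap.rTensor_tmul, LinearMap.lTensor_tmul, comul_mon, TensorProduct.sum_tmul,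
        TensorProduct.tmul_sum, TensorProduct.add_tmul, TensorProduct.tmul_add,
        ← TensorProduct.smul_tmul', TensorProduct.tmul_smul, TensorProduct.assoc_tmul, smul_add,
        Finset.smul_sum, smul_smul, mul_neg, neg_smul, map_neg, TensorProduct.neg_tmul,
        TensorProduct.tmul_neg, smul_neg, Finset.sum_add_distrib,
        Finset.sum_neg_distrib, H]
      try abel
  rTensor_counit_comp_comul := by
    refine S_hom_ext ?_
    rintro ⟨n, j, k⟩
    simp only [LinearMap.comp_apply, comul_mon]
    rcases n with _ | n <;> fin_cases j <;> fin_cases k <;>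
    simp [comulMon, split_zero, split_one, counit_mon, Finset.Nat.antidiagonal_succ]
  lTensor_counit_comp_comul := by
    refine S_hom_ext ?_
    rintro ⟨n, j, k⟩
    simp only [LinearMap.comp_apply, comul_mon]
    rcases n with _ | n <;> fin_cases j <;> fin_cases k <;>
    simp [comulMon, split_zero, split_one, counit_mon, Finset.Nat.antidiagonal_succ']

/-- The product of two monomials in the graded symmetric algebra:
`e^a e^b = (-1)^(a₃ b₂) e^(a + b)`, which is zero if `e₂` or `e₃` is repeated. -/
noncomputable def mulMon (a b : Mono) : S :=
  if h : (a.2.1 : ℕ) + b.2.1 < 2 ∧ (a.2.2 : ℕ) + b.2.2 < 2 then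
    ((-1 : ℂ) ^ ((a.2.2 : ℕ) * (b.2.1 : ℕ))) •
      mon (a.1 + b.1, ⟨(a.2.1 : ℕ) + b.2.1, h.1⟩, ⟨(a.2.2 : ℕ) + b.2.2, h.2⟩)
  else 0

/-- The product of the graded symmetric algebra `S(W)`. -/
noncomputable def mul : S →ₗ[ℂ] S →ₗ[ℂ] S := onMon fun a => onMon fun b => mulMon a b

/-- The parity involution `x ↦ (-1)^|x| x`. -/
noncomputable def parity : S →ₗ[ℂ] S :=
  onMon fun m => ((-1 : ℂ) ^ ((m.2.1 : ℕ) + (m.2.2 : ℕ))) • mon m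

/-- The homogeneous part of `S(W)` of degree `n`. -/
noncomputable def degPart (n : ℤ) : Submodule ℂ S := Submodule.span ℂ (mon '' {m | m.deg = n})

/-- A codifferential of `S(W)`: a coderivation of degree `1` with square zero
(and vanishing on the unit, so that it has components `S^r(W) → W` only for `r ≥ 1`).
The graded map `id ⊗ d` is `x ⊗ y ↦ (-1)^|x| x ⊗ d y`. -/
structure IsCodifferential (d : S →ₗ[ℂ] S) : Prop where
  degree_one : ∀ n, ∀ x ∈ degPart n, d x ∈ degPart (n + 1)
  coderivation : Coalgebra.comul ∘ₗ d =
    (TensorProduct.map d LinearMap.id + TensorProduct.map parity d) ∘ₗ Coalgebra.comul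
  map_one : d (mon (0, 0, 0)) = 0
  sq_zero : d ∘ₗ d = 0

/-- Automorphisms of the graded coalgebra `S(W)`: coalgebra automorphisms of degree `0`. -/
def IsGradedAut (g : S ≃ₗc[ℂ] S) : Prop := ∀ n, ∀ x ∈ degPart n, g x ∈ degPart n

/-- Linear automorphisms of `S(W)`: `g (w₁ ⋯ wₙ) = g w₁ ⋯ g wₙ`. -/
def IsLinearAut (g : S ≃ₗc[ℂ] S) : Prop := ∀ x y, g (mul x y) = mul (g x) (g y)

/-- `d' = g⁻¹ d g` for some automorphism `g`. -/
def Equivalent (d d' : S →ₗ[ℂ] S) : Prop :=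
  ∃ g : S ≃ₗc[ℂ] S, IsGradedAut g ∧ ∀ x, d' x = g.symm (d (g x))

/-- `d' = g⁻¹ d g` for some linear automorphism `g`. -/
def LinearlyEquivalent (d d' : S →ₗ[ℂ] S) : Prop :=
  ∃ g : S ≃ₗc[ℂ] S, IsGradedAut g ∧ IsLinearAut g ∧ ∀ x, d' x = g.symm (d (g x))

/-- The projection of `S(W)` onto `W = S^1(W)`. -/
noncomputable def toW : S →ₗ[ℂ] S := onMon fun m => if m.weight = 1 then mon m else 0

/-- The component `S^r(W) → W` of `d` vanishes for `r ≠ k`. -/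
def IsOfDegree (k : ℕ) (d : S →ₗ[ℂ] S) : Prop :=
  ∀ m : Mono, m.weight ≠ k → toW (d (mon m)) = 0

/-- The components `S^r(W) → W` of `d` and `d₀` agree for `r ≤ k`. -/
def Extends (k : ℕ) (d₀ d : S →ₗ[ℂ] S) : Prop :=
  ∀ m : Mono, m.weight ≤ k → toW (d (mon m)) = toW (d₀ (mon m))

/-- The basis vector `e₁` of `W`, of degree `0`. -/
noncomputable def e₁ : S := mon (1, 0, 0)

/-- The basis vector `e₃` of `W`, of degree `1`. -/
noncomputable def e₃ : S := mon (0, 0, 1)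

/-- The cochain `S(W) → W` with value `i₁! i₂! i₃! w` on the monomial `e^i` and `0` on the
other monomials. -/
noncomputable def psi (i : Mono) (w : S) : S →ₗ[ℂ] S :=
  onMon fun m => if m = i then
    ((i.1.factorial * (i.2.1 : ℕ).factorial * (i.2.2 : ℕ).factorial : ℕ) : ℂ) • w else 0

/-- The coderivation determined by a cochain `f : S(W) → W`, namely
`w₁ ⋯ wₙ ↦ ∑ ± f(w_{σ(1)} ⋯ w_{σ(r)}) w_{σ(r+1)} ⋯ w_{σ(n)}`, the sum over unshuffles. -/
noncomputable def coder (f : S →ₗ[ℂ] S) : S →ₗ[ℂ] S :=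
  TensorProduct.lift mul ∘ₗ TensorProduct.map f LinearMap.id ∘ₗ Coalgebra.comul

/-- `d_k(a : b)`; for `k = 1` the second cochain does not exist, and only `b = 0` is used. -/
noncomputable def dLine (k : ℕ) (a b : ℂ) : S →ₗ[ℂ] S :=
  coder (a • psi (k - 1, 1, 0) e₁ + b • psi (k - 2, 1, 1) e₃)

/-- `d_k^*`. -/
noncomputable def dStar (k : ℕ) : S →ₗ[ℂ] S := coder (psi (k, 0, 0) e₃)

/-- `d_{k,l}(α)`. -/
noncomputable def dPair (k l : ℕ) (α : ℂ) : S →ₗ[ℂ] S :=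
  coder (psi (k - 2, 1, 1) e₃ + psi (l - 1, 1, 0) e₁ + α • psi (2 * l - k - 1, 1, 0) e₁)

/-- `d^♯_{k,l}`. -/
noncomputable def dSharp (k l : ℕ) : S →ₗ[ℂ] S :=
  coder (psi (k - 1, 1, 0) e₁ + (l : ℂ) • psi (k - 2, 1, 1) e₃ + psi (l, 0, 0) e₃)

/-- Labels of the four families of normal forms. -/
inductive Label : Type
  | line (k : ℕ) (P : ℙ ℂ (Fin 2 → ℂ))
  | star (k : ℕ)
  | pair (k l : ℕ) (α : ℂ)
  | sharp (k l : ℕ)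

/-- The point `P` of the projective line is `(a : b)`. -/
def HasCoords (P : ℙ ℂ (Fin 2 → ℂ)) (a b : ℂ) : Prop :=
  ∃ h : ![a, b] ≠ 0, P = Projectivization.mk ℂ ![a, b] h

/-- The range of the parameters: all cochains that occur must exist, which for `k = 1` leaves
only `d_1(1 : 0)` and `d_1^*`. -/
def Label.Valid : Label → Prop
  | .line k P => 2 ≤ k ∨ (k = 1 ∧ HasCoords P 1 0)
  | .star k => 1 ≤ k
  | .pair k l _ => 2 ≤ k ∧ k < l
  | .sharp k l => 2 ≤ k ∧ k ≤ l

/-- The codifferentials with a given label: one of them, except that `d_k(P)` stands for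
`d_k(a : b)` for all homogeneous coordinates `(a : b)` of `P`. -/
def Label.codiffs : Label → Set (S →ₗ[ℂ] S)
  | .line k P => {d | ∃ a b, HasCoords P a b ∧ d = dLine k a b}
  | .star k => {dStar k}
  | .pair k l α => {dPair k l α}
  | .sharp k l => {dSharp k l}

/-- The labels `d_k(P)`, `d_k^*` and `d^♯_{k,k}` of codifferentials of fixed degree `k`. -/
def Label.FixedDegree (k : ℕ) (N : Label) : Prop :=
  (∃ P, N = .line k P) ∨ N = .star k ∨ N = .sharp k k

end LInf

/-!
The classification is a classification of vector fields. The linear dual of the coalgebra `S(W)` is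
the algebra of formal functions `p₀₀ + p₁₀ θ + p₀₁ η + p₁₁ θη` in an even variable `x` and odd
variables `θ`, `η` (`SuperSeries`, `pairing_superMul`). Under this duality a codifferential is an odd
vector field `a θ ∂_x + (c + b θη) ∂_η`, where `a`, `b`, `c` are power series in `x` with `c(0) = 0`
and `a c' = b c` (`isCodifferential_cod`, `IsCodifferential.exists_eq_cod`). A graded automorphism is
a coordinate change `x ↦ x φ + h θη`, `θ ↦ u θ`, `η ↦ v η` with `φ`, `u`, `v` invertible
(`exists_gradedAut`, `IsGradedAut.exists_dual_eq`), so that equivalence amounts to three equations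
between power series (`equivalent_cod_iff`).

Existence of a normal form. If `c ≠ 0`, then `b` is determined by `a` and `c`, the series `c` can be
made `x^l`, and `a` matters only modulo `x^l`; this gives `d_l^*` and `d^♯_{k,l}`. If `c = 0`, the
invariant is the meromorphic form `(b / a) dx` modulo forms without pole, since the scaling `v` adds
`v' / v` to `b / a`. A pole of order at most one leaves only the residue, giving `d_k(λ : μ)`, and a
pole of higher order is brought to the form `dx / (x^(n+1) (1 + α x^n))` by extracting an `n`-th root,
giving `d_{k,l}(α)` (`exists_residue_normal_form`).

Uniqueness. The component of lowest weight is an invariant up to scaling (`leading_of_equivalent`,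
`HasLead.eq`). It separates all labels except those extending `d_k(0 : 1)`, which are told apart by
the orders of `a` and `b` and by the residue of `b / a` (`residue_eq`), and those extending
`d_k(1 : l)`, which are told apart by `c`. The same invariant determines which label an extension of
a codifferential of fixed degree can have.
-/

namespace LInf

open PowerSeries

/-! ### Formal functions as linear functionals on `S(W)` -/

/-- A linear functional on `S(W)`, written as the formal function
`p₀₀ + p₁₀ θ + p₀₁ η + p₁₁ θη` of one even variable `x` and two odd variables `θ`, `η`, dual to
`e₁`, `e₂`, `e₃`. The entry `p j k` is the coefficient of `θ^j η^k`, a power series in `x`. -/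
abbrev SuperSeries : Type := Fin 2 → Fin 2 → ℂ⟦X⟧

/-- The value of a formal function on a monomial. The factorial makes the convolution of
functionals the ordinary product of power series (`pairing_superMul`). -/
noncomputable def SuperSeries.eval (p : SuperSeries) (m : Mono) : ℂ :=
  (m.1.factorial : ℂ) * coeff m.1 (p m.2.1 m.2.2)

/-- Formal functions are the full linear dual of `S(W)`. -/
noncomputable def pairing : SuperSeries ≃ₗ[ℂ] (S →ₗ[ℂ] ℂ) where
  toFun p := onMon p.eval
  map_add' p q := S_hom_ext fun m => by
    simp [onMon_mon, SuperSeries.eval, mul_add]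
  map_smul' r p := S_hom_ext fun m => by
    simp [onMon_mon, SuperSeries.eval, mul_left_comm]
  invFun φ := fun j k => PowerSeries.mk fun n => φ (mon (n, j, k)) / (n.factorial : ℂ)
  left_inv p := by
    ext j k n
    simp [onMon_mon, SuperSeries.eval, Nat.factorial_ne_zero]
  right_inv φ := S_hom_ext fun m => by
    have : (m.1.factorial : ℂ) ≠ 0 := by exact_mod_cast Nat.factorial_ne_zero _
    simp [onMon_mon, SuperSeries.eval]
    field_simp

lemma pairing_mon (p : SuperSeries) (m : Mono) :
    pairing p (mon m) = (m.1.factorial : ℂ) * coeff m.1 (p m.2.1 m.2.2) := onMon_mon _ m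

lemma SuperSeries.ext_pairing {p q : SuperSeries}
    (h : ∀ m, pairing p (mon m) = pairing q (mon m)) : p = q :=
  pairing.injective (S_hom_ext h)

/-- The monomial basis of `S(W)`. -/
noncomputable def basisS : Module.Basis Mono ℂ S :=
  (Finsupp.basisSingleOne : Module.Basis Mono ℂ (Mono →₀ ℂ))

lemma basisS_apply (m : Mono) : basisS m = mon m := rfl

/-- The formal function that reads off the coefficient of the monomial `m`. -/
noncomputable def coordSeries (m : Mono) : SuperSeries := pairing.symm (basisS.coord m)

lemma pairing_coordSeries (m : Mono) : pairing (coordSeries m) = basisS.coord m := by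
  simp [coordSeries]

lemma ext_pairing {x y : S} (h : ∀ p, pairing p x = pairing p y) : x = y :=
  basisS.ext_elem fun m => by
    have := h (coordSeries m)
    rwa [pairing_coordSeries] at this

/-- Products of formal functions separate the elements of `S(W) ⊗ S(W)`. -/
lemma tensor_ext {x y : S ⊗[ℂ] S}
    (h : ∀ p q, LinearMap.mul' ℂ ℂ (TensorProduct.map (pairing p) (pairing q) x) =
      LinearMap.mul' ℂ ℂ (TensorProduct.map (pairing p) (pairing q) y)) : x = y := by
  refine (basisS.tensorProduct basisS).ext_elem fun m => ?_
  have := h (coordSeries m.1) (coordSeries m.2)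
  rw [pairing_coordSeries, pairing_coordSeries] at this
  have key : (basisS.tensorProduct basisS).coord m =
      LinearMap.mul' ℂ ℂ ∘ₗ TensorProduct.map (basisS.coord m.1) (basisS.coord m.2) := by
    ext x y
    obtain ⟨i, j⟩ := m
    simp [Module.Basis.tensorProduct_repr_tmul_apply, mul_comm]
  rw [← Module.Basis.coord_apply, ← Module.Basis.coord_apply, key]
  exact this

lemma sum_choose_mul (p q : ℂ⟦X⟧) (n : ℕ) :
    ∑ x ∈ Finset.HasAntidiagonal.antidiagonal n, (n.choose x.1 : ℂ) *
      ((x.1.factorial * coeff x.1 p) * (x.2.factorial * coeff x.2 q)) =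
    n.factorial * coeff n (p * q) := by
  rw [coeff_mul, Finset.mul_sum]
  refine Finset.sum_congr rfl fun x hx => ?_
  obtain rfl := Finset.HasAntidiagonal.mem_antidiagonal.1 hx
  have h : ((x.1 + x.2).choose x.1 : ℂ) * x.1.factorial * x.2.factorial =
      (x.1 + x.2).factorial := by
    rw [Nat.choose_symm_add]
    exact_mod_cast Nat.add_choose_mul_factorial_mul_factorial x.1 x.2
  rw [← h]; ring

/-- The product of formal functions, with `θη = -ηθ`. -/
noncomputable def superMul (p q : SuperSeries) : SuperSeries :=
  ![![p 0 0 * q 0 0, p 0 0 * q 0 1 + p 0 1 * q 0 0],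
    ![p 0 0 * q 1 0 + p 1 0 * q 0 0,
      p 0 0 * q 1 1 + p 1 1 * q 0 0 + p 1 0 * q 0 1 - p 0 1 * q 1 0]]

/-- The product of formal functions is convolution with respect to the coproduct of `S(W)`. -/
lemma pairing_superMul (p q : SuperSeries) (x : S) :
    LinearMap.mul' ℂ ℂ (TensorProduct.map (pairing p) (pairing q) (Coalgebra.comul (R := ℂ) x)) =
      pairing (superMul p q) x := by
  have : (LinearMap.mul' ℂ ℂ ∘ₗ TensorProduct.map (pairing p) (pairing q) ∘ₗ
      Coalgebra.comul (R := ℂ) : S →ₗ[ℂ] ℂ) = pairing (superMul p q) := by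
    refine S_hom_ext ?_
    rintro ⟨n, j, k⟩
    simp only [LinearMap.comp_apply, comul_mon, comulMon, map_sum, map_smul, TensorProduct.map_tmul,
      LinearMap.mul'_apply, pairing_mon, smul_eq_mul]
    fin_cases j <;> fin_cases k <;>
      simp [split_zero, split_one, superMul, mul_add, mul_sub, ← sum_choose_mul,
        Finset.sum_add_distrib]
    abel
  exact LinearMap.congr_fun this x

/-! ### Transposition -/

/-- The transpose of an endomorphism of `S(W)`, acting on formal functions. -/
noncomputable def dual (d : S →ₗ[ℂ] S) : SuperSeries →ₗ[ℂ] SuperSeries :=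
  pairing.symm.toLinearMap ∘ₗ LinearMap.lcomp ℂ ℂ d ∘ₗ pairing.toLinearMap

lemma pairing_dual (d : S →ₗ[ℂ] S) (p : SuperSeries) (x : S) :
    pairing (dual d p) x = pairing p (d x) := by
  simp [dual]

lemma dual_injective : Function.Injective dual := fun d e h =>
  LinearMap.ext fun x => ext_pairing fun p => by
    rw [← pairing_dual, ← pairing_dual, h]

lemma dual_comp (d e : S →ₗ[ℂ] S) (p : SuperSeries) : dual (d ∘ₗ e) p = dual e (dual d p) :=
  SuperSeries.ext_pairing fun m => by simp [pairing_dual]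

lemma dual_id (p : SuperSeries) : dual LinearMap.id p = p :=
  SuperSeries.ext_pairing fun m => by simp [pairing_dual]

lemma dual_zero (p : SuperSeries) : dual 0 p = 0 :=
  SuperSeries.ext_pairing fun m => by simp [pairing_dual]

/-- An endomorphism of `S(W)` whose transpose is `T`, provided that `T` lowers the order in `x`
by at most one (`dual_predual`). The sum runs over those coordinates whose image under such a `T`
can be nonzero at `m`. -/
noncomputable def predual (T : SuperSeries →ₗ[ℂ] SuperSeries) : S →ₗ[ℂ] S := onMon fun m =>
  ∑ i ∈ Finset.range (m.1 + 2) ×ˢ (Finset.univ : Finset (Fin 2 × Fin 2)),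
    pairing (T (coordSeries i)) (mon m) • mon i

lemma pairing_coordSeries_mon (i m : Mono) :
    pairing (coordSeries i) (mon m) = if m = i then 1 else 0 := by
  rw [pairing_coordSeries, ← basisS_apply]
  simp [Finsupp.single_apply]

lemma dual_predual {T : SuperSeries →ₗ[ℂ] SuperSeries}
    (hT : ∀ N p, (∀ j k, X ^ (N + 1) ∣ p j k) → ∀ j k, X ^ N ∣ T p j k) : dual (predual T) = T := by
  refine LinearMap.ext fun p => SuperSeries.ext_pairing fun m => ?_
  set s := Finset.range (m.1 + 2) ×ˢ (Finset.univ : Finset (Fin 2 × Fin 2))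
  set r : SuperSeries := p - ∑ i ∈ s, pairing p (mon i) • coordSeries i with hr
  have h1 : pairing (dual (predual T) p) (mon m) =
      pairing (T (∑ i ∈ s, pairing p (mon i) • coordSeries i)) (mon m) := by
    rw [pairing_dual, predual, onMon_mon]
    simp [mul_comm, s]
  have h2 : ∀ j k, X ^ (m.1 + 2) ∣ r j k := by
    intro j k
    rw [X_pow_dvd_iff]
    intro n hn
    have : pairing r (mon (n, j, k)) = 0 := by
      simp only [hr, map_sub, map_sum, map_smul, LinearMap.sub_apply, LinearMap.sum_apply,
        LinearMap.smul_apply, pairing_coordSeries_mon, smul_eq_mul, mul_ite, mul_one, mul_zero,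
        Finset.sum_ite_eq]
      rw [if_pos (by simp [s, hn]), sub_self]
    rw [pairing_mon] at this
    simpa [Nat.factorial_ne_zero] using this
  have h3 : pairing (T r) (mon m) = 0 := by
    rw [pairing_mon, X_pow_dvd_iff.1 (hT _ _ h2 _ _) _ (Nat.lt_succ_self _), mul_zero]
  rw [h1, eq_comm, ← sub_eq_zero, ← LinearMap.sub_apply, ← map_sub, ← map_sub, ← hr, h3]

/-- The parity involution of formal functions. -/
noncomputable def sgn (p : SuperSeries) : SuperSeries := ![![p 0 0, - p 0 1], ![- p 1 0, p 1 1]]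

lemma dual_parity (p : SuperSeries) : dual parity p = sgn p := by
  refine SuperSeries.ext_pairing ?_
  rintro ⟨n, j, k⟩
  rw [pairing_dual, parity, onMon_mon, map_smul, pairing_mon, pairing_mon]
  fin_cases j <;> fin_cases k <;> simp [sgn]

lemma pairing_map_comul (p q : SuperSeries) (a b : S →ₗ[ℂ] S) (x : S) :
    LinearMap.mul' ℂ ℂ (TensorProduct.map (pairing p) (pairing q)
      (TensorProduct.map a b (Coalgebra.comul (R := ℂ) x))) =
        pairing (superMul (dual a p) (dual b q)) x := by
  rw [← pairing_superMul, ← LinearMap.comp_apply (TensorProduct.map (pairing p) (pairing q)),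
    ← TensorProduct.map_comp]
  congr 3 <;> · ext y; simp [pairing_dual]

/-- `d` is a coderivation if and only if its transpose is an odd derivation. -/
lemma coderivation_iff (d : S →ₗ[ℂ] S) :
    Coalgebra.comul ∘ₗ d =
      (TensorProduct.map d LinearMap.id + TensorProduct.map parity d) ∘ₗ Coalgebra.comul ↔
    ∀ p q, dual d (superMul p q) = superMul (dual d p) q + superMul (sgn p) (dual d q) := by
  constructor
  · intro h p q
    refine SuperSeries.ext_pairing fun m => ?_
    have := congr(LinearMap.mul' ℂ ℂ (TensorProduct.map (pairing p) (pairing q) ($h (mon m))))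
    simp only [LinearMap.comp_apply, LinearMap.add_apply, map_add, pairing_map_comul,
      pairing_superMul, dual_id, dual_parity] at this
    rw [pairing_dual, this, map_add, LinearMap.add_apply]
  · intro h
    refine LinearMap.ext fun x => tensor_ext fun p q => ?_
    simp only [LinearMap.comp_apply, LinearMap.add_apply, map_add, pairing_map_comul,
      pairing_superMul, dual_id, dual_parity]
    rw [← pairing_dual, h, map_add, LinearMap.add_apply]

/-- `g` respects the coproduct if and only if its transpose is multiplicative. -/
lemma map_comul_iff (g : S →ₗ[ℂ] S) :
    TensorProduct.map g g ∘ₗ Coalgebra.comul = Coalgebra.comul ∘ₗ g ↔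
    ∀ p q, dual g (superMul p q) = superMul (dual g p) (dual g q) := by
  constructor
  · intro h p q
    refine SuperSeries.ext_pairing fun m => ?_
    have := congr(LinearMap.mul' ℂ ℂ (TensorProduct.map (pairing p) (pairing q) ($h (mon m))))
    simp only [LinearMap.comp_apply, pairing_map_comul, pairing_superMul] at this
    rw [pairing_dual, this]
  · intro h
    refine LinearMap.ext fun x => tensor_ext fun p q => ?_
    simp only [LinearMap.comp_apply, pairing_map_comul, pairing_superMul]
    rw [← pairing_dual, h]

/-- The constant function `1`. -/
noncomputable def serOne : SuperSeries := ![![1, 0], ![0, 0]]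

lemma pairing_serOne : pairing serOne = Coalgebra.counit (R := ℂ) := S_hom_ext <| by
  rintro ⟨n, j, k⟩
  rw [pairing_mon, counit_mon]
  fin_cases j <;> fin_cases k <;> simp [serOne, coeff_one]
  rcases eq_or_ne n 0 with rfl | hn <;> simp [*]

lemma counit_iff (g : S →ₗ[ℂ] S) :
    Coalgebra.counit (R := ℂ) ∘ₗ g = Coalgebra.counit ↔ dual g serOne = serOne := by
  rw [← pairing_serOne, ← pairing.injective.eq_iff (b := serOne)]
  have : pairing (dual g serOne) = pairing serOne ∘ₗ g :=
    LinearMap.ext fun x => pairing_dual g serOne x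
  rw [this]

/-- The coefficients of `p` pairing with monomials of degree `n` vanish. -/
def VanishesAt (p : SuperSeries) (n : ℤ) : Prop :=
  ∀ j k : Fin 2, ((k : ℕ) : ℤ) - (j : ℕ) = n → p j k = 0

lemma mem_degPart_iff (x : S) (n : ℤ) :
    x ∈ degPart n ↔ ∀ p, VanishesAt p n → pairing p x = 0 := by
  constructor
  · intro hx p hp
    induction hx using Submodule.span_induction with
    | mem x hx =>
      obtain ⟨m, hm, rfl⟩ := hx
      rw [pairing_mon, hp _ _ hm, map_zero, mul_zero]
    | zero => simp
    | add x y _ _ hx hy => simp [hx, hy]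
    | smul r x _ hx => simp [hx]
  · intro h
    rw [← basisS.linearCombination_repr x, Finsupp.linearCombination_apply]
    refine Submodule.sum_mem _ fun m hm => Submodule.smul_mem _ _ ?_
    refine Submodule.subset_span ⟨m, ?_, rfl⟩
    by_contra hd
    refine (Finsupp.mem_support_iff.1 hm) ?_
    rw [← Module.Basis.coord_apply, ← pairing_coordSeries]
    refine h _ fun j k hjk => ?_
    ext i
    have := pairing_coordSeries_mon m (i, j, k)
    rw [if_neg (by rintro rfl; exact hd hjk), pairing_mon] at this
    simpa [Nat.factorial_ne_zero] using this

/-- A map of degree `s`, expressed by its transpose. -/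
lemma degree_iff (d : S →ₗ[ℂ] S) (s : ℤ) :
    (∀ n, ∀ x ∈ degPart n, d x ∈ degPart (n + s)) ↔
      ∀ n p, VanishesAt p (n + s) → VanishesAt (dual d p) n := by
  constructor
  · intro h n p hp j k hjk
    ext i
    have := (mem_degPart_iff _ _).1 (h n (mon (i, j, k)) (Submodule.subset_span ⟨_, hjk, rfl⟩)) p hp
    rw [← pairing_dual, pairing_mon] at this
    simpa [Nat.factorial_ne_zero] using this
  · intro h n x hx
    rw [mem_degPart_iff] at hx ⊢
    intro p hp
    rw [← pairing_dual]
    exact hx _ (h n p hp)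

/-! ### Coordinates -/

/-- The coordinate `x`. -/
noncomputable def serX : SuperSeries := ![![X, 0], ![0, 0]]

/-- The coordinate `θ`. -/
noncomputable def serTheta : SuperSeries := ![![0, 0], ![1, 0]]

/-- The coordinate `η`. -/
noncomputable def serEta : SuperSeries := ![![0, 1], ![0, 0]]

/-- The product `θη`. -/
noncomputable def serThetaEta : SuperSeries := ![![0, 0], ![0, 1]]

lemma SuperSeries.ext {p q : SuperSeries} (h00 : p 0 0 = q 0 0)
    (h01 : p 0 1 = q 0 1) (h10 : p 1 0 = q 1 0) (h11 : p 1 1 = q 1 1) : p = q := by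
  funext j k
  fin_cases j <;> fin_cases k <;> assumption

lemma SuperSeries.decompose (p : SuperSeries) :
    p = constantCoeff (p 0 0) • serOne + constantCoeff (p 1 0) • serTheta +
      constantCoeff (p 0 1) • serEta + constantCoeff (p 1 1) • serThetaEta +
      superMul serX (fun j k => PowerSeries.mk fun n => coeff (n + 1) (p j k)) := by
  apply SuperSeries.ext <;>
    simp [serOne, serTheta, serEta, serThetaEta, superMul, serX, smul_eq_C_mul] <;>
    nth_rw 1 [eq_X_mul_shift_add_const (p _ _)] <;> rw [add_comm]

lemma eq_zero_of_forall_X_pow_dvd {p : ℂ⟦X⟧} (h : ∀ N, X ^ N ∣ p) : p = 0 := by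
  ext n
  exact X_pow_dvd_iff.1 (h (n + 1)) n (Nat.lt_succ_self n)

/-- A linear map on formal functions that kills `1`, `θ`, `η`, `θη` and turns multiplication by
`x` into multiplication by some `f + h θη` with `f(0) = 0` is zero: its values are divisible by
arbitrary powers of `f`. Applied to differences, it shows that derivations and algebra endomorphisms
of the algebra of formal functions are determined by their values on the coordinates. -/
lemma eq_zero_of_superMul_serX {T : SuperSeries →ₗ[ℂ] SuperSeries} {f h : ℂ⟦X⟧}
    (hf : X ∣ f) (h1 : T serOne = 0) (h2 : T serTheta = 0) (h3 : T serEta = 0) (h4 : T serThetaEta = 0)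
    (hT : ∀ p, T (superMul serX p) = superMul ![![f, 0], ![0, h]] (T p)) : T = 0 := by
  have step : ∀ p, ∃ p', T p = superMul ![![f, 0], ![0, h]] (T p') := fun p =>
    ⟨_, by conv_lhs => rw [SuperSeries.decompose p]
           simp only [map_add, map_smul, h1, h2, h3, h4, smul_zero, zero_add]
           exact hT _⟩
  -- the `θη` component of `h θη * T p'` involves the `1` component of `T p'`, so it comes last
  have A : ∀ j k, (j, k) ≠ (1, 1) → ∀ p, T p j k = 0 := by
    intro j k hjk p
    refine eq_zero_of_forall_X_pow_dvd fun N => ?_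
    induction N generalizing p with
    | zero => simp
    | succ N ih =>
      obtain ⟨p', hp'⟩ := step p
      have : T p j k = f * T p' j k := by
        rw [hp']
        fin_cases j <;> fin_cases k <;> simp [superMul] at hjk ⊢
      rw [this, pow_succ']
      exact mul_dvd_mul hf (ih p')
  have B : ∀ p, T p 1 1 = 0 := by
    intro p
    refine eq_zero_of_forall_X_pow_dvd fun N => ?_
    induction N generalizing p with
    | zero => simp
    | succ N ih =>
      obtain ⟨p', hp'⟩ := step p
      have : T p 1 1 = f * T p' 1 1 := by
        rw [hp']
        simp [superMul, A 0 0 (by simp) p']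
      rw [this, pow_succ']
      exact mul_dvd_mul hf (ih p')
  refine LinearMap.ext fun p => SuperSeries.ext ?_ ?_ ?_ ?_ <;> simp [A, B]

/-! ### Codifferentials as vector fields -/

/-- The odd vector field `a θ ∂_x + (c + b θη) ∂_η` on formal functions. -/
noncomputable def vectorField (a b c : ℂ⟦X⟧) : SuperSeries →ₗ[ℂ] SuperSeries where
  toFun p := ![![p 0 1 * c, 0],
    ![derivative ℂ (p 0 0) * a - p 1 1 * c, derivative ℂ (p 0 1) * a + p 0 1 * b]]
  map_add' p q := by
    apply SuperSeries.ext <;> simp <;> ring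
  map_smul' r p := by
    apply SuperSeries.ext <;> simp [smul_sub]

lemma vectorField_apply (a b c : ℂ⟦X⟧) (p : SuperSeries) : vectorField a b c p = ![![p 0 1 * c, 0],
    ![derivative ℂ (p 0 0) * a - p 1 1 * c, derivative ℂ (p 0 1) * a + p 0 1 * b]] := rfl

lemma X_pow_dvd_derivative {p : ℂ⟦X⟧} {N : ℕ} (h : X ^ (N + 1) ∣ p) : X ^ N ∣ derivative ℂ p := by
  rw [X_pow_dvd_iff] at h ⊢
  intro m hm
  rw [coeff_derivative, h _ (by omega), zero_mul]

/-- The coderivation of `S(W)` dual to the vector field `a θ ∂_x + (c + b θη) ∂_η`. -/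
noncomputable def cod (a b c : ℂ⟦X⟧) : S →ₗ[ℂ] S := predual (vectorField a b c)

lemma dual_cod (a b c : ℂ⟦X⟧) : dual (cod a b c) = vectorField a b c := by
  refine dual_predual fun N p hp => ?_
  have h : ∀ j k, X ^ N ∣ p j k := fun j k => (pow_dvd_pow _ (Nat.le_succ N)).trans (hp j k)
  intro j k
  fin_cases j <;> fin_cases k <;> simp only [vectorField_apply]
  · exact (h 0 1).mul_right _
  · exact dvd_zero _
  · exact dvd_sub ((X_pow_dvd_derivative (hp 0 0)).mul_right _) ((h 1 1).mul_right _)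
  · exact dvd_add ((X_pow_dvd_derivative (hp 0 1)).mul_right _) ((h 0 1).mul_right _)

/-- The condition `a c' = b c` says that the vector field `a θ ∂_x + (c + b θη) ∂_η` has square
zero, and `c(0) = 0` says that it vanishes at the origin. -/
lemma isCodifferential_cod {a b c : ℂ⟦X⟧} (hc : constantCoeff c = 0)
    (h : a * derivative ℂ c = b * c) : IsCodifferential (cod a b c) where
  degree_one := by
    rw [degree_iff, dual_cod]
    intro n p hp j k hjk
    have h1 : n = 0 → p 0 1 = 0 := fun hn => hp 0 1 (by simp [hn])
    have h2 : n = -1 → p 0 0 = 0 ∧ p 1 1 = 0 := fun hn =>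
      ⟨hp 0 0 (by simp [hn]), hp 1 1 (by simp [hn])⟩
    fin_cases j <;> fin_cases k <;> simp [vectorField_apply] at hjk ⊢
    · simp [h1 hjk.symm]
    · simp [h2 hjk.symm]
    · simp [h1 hjk.symm]
  coderivation := by
    rw [coderivation_iff, dual_cod]
    intro p q
    apply SuperSeries.ext <;> simp [vectorField_apply, superMul, sgn] <;> ring
  map_one := by
    refine ext_pairing fun p => ?_
    rw [← pairing_dual, dual_cod, pairing_mon]
    simp [vectorField_apply, hc]
  sq_zero := by
    refine dual_injective (LinearMap.ext fun p => ?_)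
    rw [dual_comp, dual_cod, dual_zero]
    apply SuperSeries.ext <;> simp [vectorField_apply]
    linear_combination (p 0 1) * h

/-- For reasons of degree, the derivation dual to a codifferential maps `x` to a multiple of `θ`,
`θ` to `0` and `η` to some `c + b θη`; hence it is a `vectorField`. -/
lemma IsCodifferential.exists_eq_cod {d : S →ₗ[ℂ] S} (hd : IsCodifferential d) :
    ∃ a b c : ℂ⟦X⟧, constantCoeff c = 0 ∧ a * derivative ℂ c = b * c ∧ d = cod a b c := by
  have hdeg := (degree_iff d 1).1 hd.degree_one
  have hder := (coderivation_iff d).1 hd.coderivation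
  have hx0 := hdeg 0 serX (by
    intro j k; fin_cases j <;> fin_cases k <;> simp [serX])
  have hx1 := hdeg 1 serX (by
    intro j k; fin_cases j <;> fin_cases k <;> simp [serX])
  have ht : ∀ n, n = 0 ∨ n = -1 ∨ n = 1 → VanishesAt (dual d serTheta) n := fun n hn => hdeg n _ (by
    rcases hn with rfl | rfl | rfl <;>
    intro j k <;> fin_cases j <;> fin_cases k <;> simp [serTheta])
  have he : ∀ n, n = -1 ∨ n = 1 → VanishesAt (dual d serEta) n := fun n hn => hdeg n _ (by
    rcases hn with rfl | rfl <;>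
    intro j k <;> fin_cases j <;> fin_cases k <;> simp [serEta])
  have hone : dual d serOne = 0 := by
    have := hder serOne serOne
    have e1 : superMul serOne serOne = serOne := by
      apply SuperSeries.ext <;> simp [superMul, serOne]
    have e2 : superMul (dual d serOne) serOne = dual d serOne := by
      apply SuperSeries.ext <;> simp [superMul, serOne]
    have e3 : superMul (sgn serOne) (dual d serOne) = dual d serOne := by
      apply SuperSeries.ext <;> simp [superMul, serOne, sgn]
    rw [e1, e2, e3] at this
    simpa using this
  have htheta : dual d serTheta = 0 := SuperSeries.ext (ht 0 (by simp) 0 0 (by simp))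
    (ht 1 (by simp) 0 1 (by simp)) (ht (-1) (by simp) 1 0 (by simp)) (ht 0 (by simp) 1 1 (by simp))
  set a := dual d serX 1 0 with ha
  set c := dual d serEta 0 0 with hc
  set b := dual d serEta 1 1 with hb
  have hx : dual d serX = vectorField a b c serX := by
    apply SuperSeries.ext
    · rw [hx0 0 0 (by simp)]
      simp [vectorField_apply, serX]
    · rw [hx1 0 1 (by simp)]
      simp [vectorField_apply, serX]
    · simp [vectorField_apply, serX, ha]
    · rw [hx0 1 1 (by simp)]
      simp [vectorField_apply, serX]
  have heta : dual d serEta = vectorField a b c serEta := by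
    apply SuperSeries.ext
    · simp [vectorField_apply, serEta, hc]
    · rw [he 1 (by simp) 0 1 (by simp)]
      simp [vectorField_apply, serEta]
    · rw [he (-1) (by simp) 1 0 (by simp)]
      simp [vectorField_apply, serEta]
    · simp [vectorField_apply, serEta, hb]
  have hdual : dual d = vectorField a b c := by
    rw [← sub_eq_zero]
    refine eq_zero_of_superMul_serX (f := X) (h := 0) dvd_rfl ?_ ?_ ?_ ?_ ?_
    · rw [LinearMap.sub_apply, hone]
      apply SuperSeries.ext <;> simp [vectorField_apply, serOne]
    · rw [LinearMap.sub_apply, htheta]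
      apply SuperSeries.ext <;> simp [vectorField_apply, serTheta]
    · rw [LinearMap.sub_apply, heta, sub_self]
    · have e1 : serThetaEta = superMul serTheta serEta := by
        apply SuperSeries.ext <;> simp [superMul, serTheta, serEta, serThetaEta]
      rw [LinearMap.sub_apply]
      nth_rw 1 [e1]
      rw [hder, htheta, heta]
      apply SuperSeries.ext <;>
        simp [vectorField_apply, superMul, sgn, serTheta, serEta, serThetaEta]
    · intro p
      rw [LinearMap.sub_apply, hder, hx]
      apply SuperSeries.ext <;> simp [vectorField_apply, superMul, sgn, serX] <;> ring
  have hd' : d = cod a b c := dual_injective (by rw [hdual, dual_cod])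
  refine ⟨a, b, c, ?_, ?_, hd'⟩
  · have := congr(pairing serEta $(hd.map_one))
    rw [← pairing_dual, pairing_mon] at this
    simpa using this
  · have := congr(dual $(hd.sq_zero) serEta 1 0)
    rw [dual_comp, hdual, dual_zero] at this
    simp [vectorField_apply, serEta] at this
    linear_combination this

/-! ### Substitution in power series -/

lemma hasSubst_X_mul (φ : ℂ⟦X⟧) : HasSubst (X * φ) := HasSubst.of_constantCoeff_zero' (by simp)

/-- The substitution `p(x) ↦ p(x φ(x))`. Writing a change of variable without constant term as
`x φ(x)` makes the substitution an algebra homomorphism for every `φ`; it is invertible if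
`φ(0) ≠ 0`. -/
noncomputable def precomp (φ : ℂ⟦X⟧) : ℂ⟦X⟧ →ₐ[ℂ] ℂ⟦X⟧ := substAlgHom (hasSubst_X_mul φ)

lemma precomp_apply (φ p : ℂ⟦X⟧) : precomp φ p = p.subst (X * φ) := by
  rw [precomp, coe_substAlgHom]

@[simp] lemma precomp_X (φ : ℂ⟦X⟧) : precomp φ X = X * φ := by
  rw [precomp_apply, subst_X (hasSubst_X_mul φ)]

@[simp] lemma precomp_C (φ : ℂ⟦X⟧) (r : ℂ) : precomp φ (C r) = C r := (precomp φ).commutes r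

@[simp] lemma precomp_one (p : ℂ⟦X⟧) : precomp 1 p = p := by
  rw [precomp_apply, mul_one, X_subst]

lemma derivative_X_mul (φ : ℂ⟦X⟧) : derivative ℂ (X * φ) = φ + X * derivative ℂ φ := by
  simp [Derivation.leibniz, add_comm]

lemma derivative_precomp (φ p : ℂ⟦X⟧) :
    derivative ℂ (precomp φ p) = precomp φ (derivative ℂ p) * (φ + X * derivative ℂ φ) := by
  rw [precomp_apply, precomp_apply, ← derivative_X_mul]
  exact derivative_subst (hasSubst_X_mul φ)

lemma precomp_precomp (φ ψ p : ℂ⟦X⟧) :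
    precomp φ (precomp ψ p) = precomp (φ * precomp φ ψ) p := by
  have h : X * (φ * precomp φ ψ) = subst (X * φ) (X * ψ) := by
    rw [← precomp_apply, map_mul, precomp_X]; ring
  rw [precomp_apply φ, precomp_apply ψ, precomp_apply, h]
  exact subst_comp_subst_apply (hasSubst_X_mul ψ) (hasSubst_X_mul φ) p

lemma eq_C_add_X_mul (p : ℂ⟦X⟧) :
    ∃ q, p = C (constantCoeff p) + X * q ∧ constantCoeff q = coeff 1 p :=
  ⟨_, (eq_X_mul_shift_add_const p).trans (add_comm _ _), by simp⟩

@[simp] lemma constantCoeff_precomp (φ p : ℂ⟦X⟧) :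
    constantCoeff (precomp φ p) = constantCoeff p := by
  obtain ⟨q, hq, -⟩ := eq_C_add_X_mul p
  conv_lhs => rw [hq]
  simp

lemma coeff_one_precomp (φ p : ℂ⟦X⟧) :
    coeff 1 (precomp φ p) = constantCoeff φ * coeff 1 p := by
  obtain ⟨q, hq, hq1⟩ := eq_C_add_X_mul p
  conv_lhs => rw [hq]
  have : coeff 1 (X * (φ * precomp φ q)) = coeff 0 (φ * precomp φ q) := coeff_succ_X_mul 0 _
  rw [map_add, map_mul, precomp_X, mul_assoc, map_add, this, precomp_C]
  simp [hq1]

lemma X_pow_dvd_precomp {φ p : ℂ⟦X⟧} {N : ℕ} (h : X ^ N ∣ p) : X ^ N ∣ precomp φ p := by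
  obtain ⟨q, rfl⟩ := h
  simp only [map_mul, map_pow, precomp_X, mul_pow, mul_assoc]
  exact dvd_mul_right _ _

/-- The compositional inverse of `x φ(x)`, written as `x ψ(x)`. -/
lemma exists_precomp_mul_eq_one {φ : ℂ⟦X⟧} (hφ : constantCoeff φ ≠ 0) :
    ∃ ψ, φ * precomp φ ψ = 1 := by
  have h1 : coeff 1 (X * φ) = constantCoeff φ := by
    simp
  have hu : IsUnit (coeff 1 (X * φ)) := by rw [h1]; exact hφ.isUnit
  have h0 : constantCoeff (X * φ) = 0 := by simp
  obtain ⟨ψ, hψ⟩ := X_dvd_iff.2 (constantCoeff_substInvOfIsUnit (X * φ) hu)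
  have := subst_substInvOfIsUnit_left (X * φ) h0 hu
  rw [hψ, ← precomp_apply, map_mul, precomp_X, mul_assoc] at this
  exact ⟨ψ, mul_left_cancel₀ X_ne_zero (this.trans (mul_one _).symm)⟩

/-! ### Graded automorphisms as coordinate changes -/

/-- The endomorphism `x ↦ x φ + h θη`, `θ ↦ u θ`, `η ↦ v η` of the algebra of formal functions. -/
noncomputable def pullback (φ u v h : ℂ⟦X⟧) : SuperSeries →ₗ[ℂ] SuperSeries where
  toFun p := ![![precomp φ (p 0 0), v * precomp φ (p 0 1)],
    ![u * precomp φ (p 1 0), h * precomp φ (derivative ℂ (p 0 0)) + u * v * precomp φ (p 1 1)]]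
  map_add' p q := by
    apply SuperSeries.ext <;> simp <;> ring
  map_smul' r p := by
    apply SuperSeries.ext <;> simp

lemma pullback_apply (φ u v h : ℂ⟦X⟧) (p : SuperSeries) :
    pullback φ u v h p = ![![precomp φ (p 0 0), v * precomp φ (p 0 1)],
    ![u * precomp φ (p 1 0), h * precomp φ (derivative ℂ (p 0 0)) + u * v * precomp φ (p 1 1)]] :=
  rfl

lemma dual_predual_pullback (φ u v h : ℂ⟦X⟧) :
    dual (predual (pullback φ u v h)) = pullback φ u v h := by
  refine dual_predual fun N p hp => ?_
  have hh : ∀ j k, X ^ N ∣ precomp φ (p j k) := fun j k =>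
    X_pow_dvd_precomp ((pow_dvd_pow _ (Nat.le_succ N)).trans (hp j k))
  intro j k
  fin_cases j <;> fin_cases k <;> simp only [pullback_apply]
  · exact hh 0 0
  · exact (hh 0 1).mul_left _
  · exact (hh 1 0).mul_left _
  · exact dvd_add ((X_pow_dvd_precomp (X_pow_dvd_derivative (hp 0 0))).mul_left _)
      ((hh 1 1).mul_left _)

lemma pullback_superMul (φ u v h : ℂ⟦X⟧) (p q : SuperSeries) :
    pullback φ u v h (superMul p q) = superMul (pullback φ u v h p) (pullback φ u v h q) := by
  apply SuperSeries.ext <;> simp [pullback_apply, superMul] <;> ring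

lemma pullback_serOne (φ u v h : ℂ⟦X⟧) : pullback φ u v h serOne = serOne := by
  apply SuperSeries.ext <;> simp [pullback_apply, serOne]

lemma pullback_comp {φ u v h φ' u' v' h' : ℂ⟦X⟧} (hφ : φ * precomp φ φ' = 1)
    (hu : u * precomp φ u' = 1) (hv : v * precomp φ v' = 1)
    (hh : h * precomp φ (derivative ℂ (X * φ')) + u * v * precomp φ h' = 0) (p : SuperSeries) :
    pullback φ u v h (pullback φ' u' v' h' p) = p := by
  have key : ∀ q : ℂ⟦X⟧, precomp φ (precomp φ' q) = q := fun q => by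
    rw [precomp_precomp, hφ, precomp_one]
  rw [derivative_X_mul] at hh
  apply SuperSeries.ext <;> simp only [pullback_apply, map_mul, map_add, derivative_precomp, key,
    Matrix.cons_val_zero, Matrix.cons_val_one]
  · rw [← mul_assoc, hv, one_mul]
  · rw [← mul_assoc, hu, one_mul]
  · simp only [map_add, map_mul] at hh
    linear_combination derivative ℂ (p 0 0) * hh + p 1 1 * v * precomp φ v' * hu + p 1 1 * hv

lemma exists_pullback_comp {φ u v : ℂ⟦X⟧} (h : ℂ⟦X⟧) (hφ : constantCoeff φ ≠ 0)
    (hu : constantCoeff u ≠ 0) (hv : constantCoeff v ≠ 0) :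
    ∃ φ' u' v' h', constantCoeff φ' ≠ 0 ∧ constantCoeff u' ≠ 0 ∧ constantCoeff v' ≠ 0 ∧
      ∀ p, pullback φ u v h (pullback φ' u' v' h' p) = p := by
  obtain ⟨φ', hφ'⟩ := exists_precomp_mul_eq_one hφ
  have hφ0 : constantCoeff φ' ≠ 0 := fun h0 => by
    simpa [h0] using congr(constantCoeff $hφ')
  have hinv : precomp φ φ' = φ⁻¹ := by
    rw [eq_inv_iff_mul_eq_one hφ, mul_comm, hφ']
  have hkey : ∀ q, precomp φ (precomp φ' q) = q := fun q => by
    rw [precomp_precomp, hφ', precomp_one]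
  refine ⟨φ', precomp φ' u⁻¹, precomp φ' v⁻¹,
    precomp φ' (- (h * precomp φ (derivative ℂ (X * φ')) * u⁻¹ * v⁻¹)), hφ0, by simpa using hu,
    by simpa using hv, pullback_comp hφ' ?_ ?_ ?_⟩
  · rw [hkey, PowerSeries.mul_inv_cancel _ hu]
  · rw [hkey, PowerSeries.mul_inv_cancel _ hv]
  · rw [hkey]
    have h1 := PowerSeries.mul_inv_cancel _ hu
    have h2 := PowerSeries.mul_inv_cancel _ hv
    linear_combination (- h * precomp φ (derivative ℂ (X * φ'))) * (h2 + v * v⁻¹ * h1)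

lemma isGradedAut_iff (g : S ≃ₗc[ℂ] S) : IsGradedAut g ↔
    ∀ n p, VanishesAt p n → VanishesAt (dual (g : S →ₗ[ℂ] S) p) n := by
  have := degree_iff (g : S →ₗ[ℂ] S) 0
  unfold IsGradedAut
  simpa using this

/-- Every invertible coordinate change is dual to a graded automorphism of `S(W)`. -/
lemma exists_gradedAut {φ u v : ℂ⟦X⟧} (h : ℂ⟦X⟧) (hφ : constantCoeff φ ≠ 0)
    (hu : constantCoeff u ≠ 0) (hv : constantCoeff v ≠ 0) :
    ∃ g : S ≃ₗc[ℂ] S, IsGradedAut g ∧ dual (g : S →ₗ[ℂ] S) = pullback φ u v h := by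
  obtain ⟨φ', u', v', h', hφ', hu', hv', H⟩ := exists_pullback_comp h hφ hu hv
  obtain ⟨φ'', u'', v'', h'', -, -, -, H'⟩ := exists_pullback_comp h' hφ' hu' hv'
  -- the right inverse has a right inverse of its own, so it is a two-sided inverse
  have H'' : ∀ p, pullback φ' u' v' h' (pullback φ u v h p) = p := fun p => by
    rw [← H' p, H (pullback φ'' u'' v'' h'' p)]
  set g := predual (pullback φ u v h) with hg
  have hdual : dual g = pullback φ u v h := dual_predual_pullback φ u v h
  set g' := predual (pullback φ' u' v' h') with hg'
  have hdual' : dual g' = pullback φ' u' v' h' := dual_predual_pullback φ' u' v' h'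
  have h1 : g ∘ₗ g' = LinearMap.id := dual_injective <| LinearMap.ext fun p => by
    rw [dual_comp, hdual, hdual', H'', dual_id]
  have h2 : g' ∘ₗ g = LinearMap.id := dual_injective <| LinearMap.ext fun p => by
    rw [dual_comp, hdual, hdual', H, dual_id]
  let e : S ≃ₗc[ℂ] S :=
    { g with
      invFun := g'
      left_inv := fun x => LinearMap.congr_fun h2 x
      right_inv := fun x => LinearMap.congr_fun h1 x
      counit_comp := (counit_iff g).2 (by rw [hdual, pullback_serOne])
      map_comp_comul := (map_comul_iff g).2 fun p q => by rw [hdual, pullback_superMul] }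
  have he : (e : S →ₗ[ℂ] S) = g := rfl
  refine ⟨e, (isGradedAut_iff e).2 ?_, by rw [he, hdual]⟩
  rw [he, hdual]
  intro n p hp j k hjk
  fin_cases j <;> fin_cases k <;> simp [pullback_apply] at hjk ⊢
  · simp [hp 0 0 (by simp [← hjk])]
  · simp [hp 0 1 (by simp [← hjk])]
  · simp [hp 1 0 (by simp [← hjk])]
  · simp [hp 0 0 (by simp [← hjk]), hp 1 1 (by simp [← hjk])]

/-- Every element of `S(W)` pairs to zero with the formal functions of high order in `x`. -/
lemma exists_pairing_eq_zero (x : S) :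
    ∃ N, ∀ p : SuperSeries, (∀ j k, X ^ N ∣ p j k) → pairing p x = 0 := by
  refine ⟨(basisS.repr x).support.sup (·.1) + 1, fun p hp => ?_⟩
  rw [← basisS.linearCombination_repr x, Finsupp.linearCombination_apply, Finsupp.sum, map_sum]
  refine Finset.sum_eq_zero fun m hm => ?_
  rw [map_smul, basisS_apply, pairing_mon, X_pow_dvd_iff.1 (hp m.2.1 m.2.2) m.1
    (Nat.lt_succ_of_le (Finset.le_sup (f := fun m : Mono => m.1) hm)), mul_zero, smul_zero]

lemma mon_ne_zero (m : Mono) : mon m ≠ 0 := by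
  rw [← basisS_apply]; exact basisS.ne_zero m

/-- Every graded automorphism of `S(W)` is dual to an invertible coordinate change. -/
lemma IsGradedAut.exists_dual_eq {g : S ≃ₗc[ℂ] S} (hg : IsGradedAut g) :
    ∃ φ u v h, constantCoeff φ ≠ 0 ∧ constantCoeff u ≠ 0 ∧ constantCoeff v ≠ 0 ∧
      dual (g : S →ₗ[ℂ] S) = pullback φ u v h := by
  rw [isGradedAut_iff] at hg
  set T := dual (g : S →ₗ[ℂ] S) with hT
  have hmul : ∀ p q, T (superMul p q) = superMul (T p) (T q) :=
    (map_comul_iff _).1 (CoalgHomClass.map_comp_comul g)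
  have hone : T serOne = serOne := (counit_iff _).1 (CoalgHomClass.counit_comp g)
  have hx : ∀ n, n = -1 ∨ n = 1 → VanishesAt (T serX) n := fun n hn => hg n _ (by
    rcases hn with rfl | rfl <;>
    intro j k <;> fin_cases j <;> fin_cases k <;> simp [serX])
  have ht : ∀ n, n = 0 ∨ n = 1 → VanishesAt (T serTheta) n := fun n hn => hg n _ (by
    rcases hn with rfl | rfl <;>
    intro j k <;> fin_cases j <;> fin_cases k <;> simp [serTheta])
  have he : ∀ n, n = 0 ∨ n = -1 → VanishesAt (T serEta) n := fun n hn => hg n _ (by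
    rcases hn with rfl | rfl <;>
    intro j k <;> fin_cases j <;> fin_cases k <;> simp [serEta])
  -- a nonzero constant term would make `g 1` pair nontrivially with all powers of `x`
  have hf0 : constantCoeff (T serX 0 0) = 0 := by
    by_contra hne
    have hpow : ∀ n, T ![![X ^ n, 0], ![0, 0]] 0 0 = T serX 0 0 ^ n := by
      intro n
      induction n with
      | zero => simpa [serOne] using congr_fun₂ hone 0 0
      | succ n ih =>
        have : (![![X ^ (n + 1), 0], ![0, 0]] : SuperSeries) =
            superMul serX ![![X ^ n, 0], ![0, 0]] := by
          apply SuperSeries.ext <;> simp [superMul, serX, pow_succ']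
        rw [this, hmul, pow_succ', ← ih]
        simp [superMul]
    obtain ⟨N, hN⟩ := exists_pairing_eq_zero (g (mon (0, 0, 0)))
    have h1 := hN ![![X ^ N, 0], ![0, 0]] (by
      intro j k; fin_cases j <;> fin_cases k <;> simp)
    have h2 := pairing_dual (g : S →ₗ[ℂ] S) ![![X ^ N, 0], ![0, 0]] (mon (0, 0, 0))
    rw [pairing_mon, ← hT] at h2
    simp only [hpow] at h2
    refine pow_ne_zero N hne ?_
    simpa using h2.trans h1
  obtain ⟨φ, hφ⟩ := X_dvd_iff.2 hf0
  set u := T serTheta 1 0 with hu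
  set v := T serEta 0 1 with hv
  set h := T serX 1 1 with hh
  have Hx : T serX = pullback φ u v h serX := by
    apply SuperSeries.ext
    · rw [hφ]; simp [pullback_apply, serX]
    · rw [hx 1 (by simp) 0 1 (by simp)]; simp [pullback_apply, serX]
    · rw [hx (-1) (by simp) 1 0 (by simp)]; simp [pullback_apply, serX]
    · rw [← hh]; simp [pullback_apply, serX]
  have Ht : T serTheta = pullback φ u v h serTheta := by
    apply SuperSeries.ext
    · rw [ht 0 (by simp) 0 0 (by simp)]; simp [pullback_apply, serTheta]
    · rw [ht 1 (by simp) 0 1 (by simp)]; simp [pullback_apply, serTheta]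
    · rw [← hu]; simp [pullback_apply, serTheta]
    · rw [ht 0 (by simp) 1 1 (by simp)]; simp [pullback_apply, serTheta]
  have He : T serEta = pullback φ u v h serEta := by
    apply SuperSeries.ext
    · rw [he 0 (by simp) 0 0 (by simp)]; simp [pullback_apply, serEta]
    · rw [← hv]; simp [pullback_apply, serEta]
    · rw [he (-1) (by simp) 1 0 (by simp)]; simp [pullback_apply, serEta]
    · rw [he 0 (by simp) 1 1 (by simp)]; simp [pullback_apply, serEta]
  have hTG : T = pullback φ u v h := by
    rw [← sub_eq_zero]
    refine eq_zero_of_superMul_serX (f := X * φ) (h := h) (dvd_mul_right _ _) ?_ ?_ ?_ ?_ ?_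
    · rw [LinearMap.sub_apply, hone, pullback_serOne, sub_self]
    · rw [LinearMap.sub_apply, Ht, sub_self]
    · rw [LinearMap.sub_apply, He, sub_self]
    · have e1 : serThetaEta = superMul serTheta serEta := by
        apply SuperSeries.ext <;> simp [superMul, serTheta, serEta, serThetaEta]
      rw [LinearMap.sub_apply, e1, hmul, pullback_superMul, Ht, He, sub_self]
    · intro p
      rw [LinearMap.sub_apply, hmul, pullback_superMul, Hx]
      apply SuperSeries.ext <;> simp [pullback_apply, superMul, serX] <;> ring
  have hinj : ∀ x, (∀ p, pairing (pullback φ u v h p) x = 0) → x = 0 := by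
    intro x hx0
    apply (map_eq_zero_iff g (EquivLike.injective g)).1
    refine ext_pairing fun p => ?_
    rw [map_zero, ← hx0 p, ← hTG, hT, pairing_dual]
    rfl
  refine ⟨φ, u, v, h, fun h0 => ?_, fun h0 => ?_, fun h0 => ?_, hTG⟩
  · refine mon_ne_zero (1, 0, 0) (hinj _ fun p => ?_)
    rw [pairing_mon]
    simp [pullback_apply, coeff_one_precomp, h0]
  · refine mon_ne_zero (0, 1, 0) (hinj _ fun p => ?_)
    rw [pairing_mon]
    simp [pullback_apply, h0]
  · refine mon_ne_zero (0, 0, 1) (hinj _ fun p => ?_)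
    rw [pairing_mon]
    simp [pullback_apply, h0]

/-! ### Equivalence -/

lemma IsGradedAut.symm {g : S ≃ₗc[ℂ] S} (hg : IsGradedAut g) : IsGradedAut g.symm := by
  -- `g` commutes with the projections `π n` onto the homogeneous parts, hence so does its inverse
  let π : ℤ → S →ₗ[ℂ] S := fun n => onMon fun m => if m.deg = n then mon m else 0
  have hπ : ∀ n x, x ∈ degPart n ↔ π n x = x := by
    intro n x
    constructor
    · intro hx
      induction hx using Submodule.span_induction with
      | mem x hx =>
        obtain ⟨m, hm, rfl⟩ := hx
        exact (onMon_mon _ m).trans (if_pos hm)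
      | zero => simp
      | add x y _ _ hx hy => rw [map_add, hx, hy]
      | smul r x _ hx => rw [map_smul, hx]
    · intro hx
      rw [← hx, ← basisS.linearCombination_repr x, Finsupp.linearCombination_apply, Finsupp.sum,
        map_sum]
      refine Submodule.sum_mem _ fun m _ => ?_
      rw [map_smul, basisS_apply, onMon_mon]
      split_ifs with h
      · exact Submodule.smul_mem _ _ (Submodule.subset_span ⟨m, h, rfl⟩)
      · simp
  have hcomm : ∀ n x, g (π n x) = π n (g x) := by
    intro n x
    have : (g : S →ₗ[ℂ] S) ∘ₗ π n = π n ∘ₗ (g : S →ₗ[ℂ] S) := S_hom_ext fun m => by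
      have h1 : g (mon m) ∈ degPart m.deg := hg _ _ (Submodule.subset_span ⟨m, rfl, rfl⟩)
      have h2 : π n (mon m) = if m.deg = n then mon m else 0 := onMon_mon _ m
      change g (π n (mon m)) = π n (g (mon m))
      rw [h2]
      split_ifs with h
      · rw [← h]; exact ((hπ _ _).1 h1).symm
      · rw [← (hπ _ _).1 h1, map_zero]
        have h3 : π n ∘ₗ π m.deg = 0 := S_hom_ext fun m' => by
          simp only [LinearMap.comp_apply, π, onMon_mon]
          split_ifs with h4
          · rw [onMon_mon, if_neg (by omega)]; rfl
          · simp
        exact (LinearMap.congr_fun h3 _).symm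
    exact LinearMap.congr_fun this x
  intro n x hx
  rw [hπ] at hx ⊢
  apply EquivLike.injective g
  rw [hcomm, CoalgEquiv.apply_symm_apply, hx]

lemma Equivalent.symm {d d' : S →ₗ[ℂ] S} (h : Equivalent d d') : Equivalent d' d := by
  obtain ⟨g, hg, hd⟩ := h
  refine ⟨g.symm, hg.symm, fun x => ?_⟩
  rw [hd, CoalgEquiv.apply_symm_apply]
  exact (CoalgEquiv.apply_symm_apply g _).symm

lemma Equivalent.trans {d d' d'' : S →ₗ[ℂ] S} (h : Equivalent d d') (h' : Equivalent d' d'') :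
    Equivalent d d'' := by
  obtain ⟨g, hg, hd⟩ := h
  obtain ⟨g', hg', hd'⟩ := h'
  refine ⟨g'.trans g, fun n x hx => hg n _ (hg' n x hx), fun x => ?_⟩
  rw [hd', hd]; rfl

lemma LinearlyEquivalent.equivalent {d d' : S →ₗ[ℂ] S} (h : LinearlyEquivalent d d') :
    Equivalent d d' :=
  let ⟨g, hg, _, hd⟩ := h
  ⟨g, hg, hd⟩

/-- Conjugation by an automorphism, expressed by transposes. -/
lemma conj_iff (g : S ≃ₗc[ℂ] S) (d d' : S →ₗ[ℂ] S) : (∀ x, d' x = g.symm (d (g x))) ↔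
    ∀ p, dual (g : S →ₗ[ℂ] S) (dual d p) = dual d' (dual (g : S →ₗ[ℂ] S) p) := by
  have h1 : (∀ x, d' x = g.symm (d (g x))) ↔ (g : S →ₗ[ℂ] S) ∘ₗ d' = d ∘ₗ (g : S →ₗ[ℂ] S) := by
    refine ⟨fun h => LinearMap.ext fun x => ?_, fun h x => ?_⟩
    · change g (d' x) = d (g x)
      rw [h, CoalgEquiv.apply_symm_apply]
    · have : g (d' x) = d (g x) := LinearMap.congr_fun h x
      rw [← this, CoalgEquiv.symm_apply_apply]
  rw [h1, ← dual_injective.eq_iff, LinearMap.ext_iff]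
  simp only [dual_comp]
  exact forall_congr' fun p => eq_comm

lemma pullback_vectorField_eq_iff {φ u v h A B C a b c : ℂ⟦X⟧} :
    (∀ p, pullback φ u v h (vectorField A B C p) = vectorField a b c (pullback φ u v h p)) ↔
      u * precomp φ A = a * (φ + X * derivative ℂ φ) - h * c ∧
      precomp φ C = v * c ∧
      h * precomp φ (derivative ℂ C) + u * v * precomp φ B = derivative ℂ v * a + v * b := by
  constructor
  · intro H
    refine ⟨?_, ?_, ?_⟩
    · simpa [pullback_apply, vectorField_apply, serX, derivative_X_mul, mul_comm] using
        congr_fun₂ (H serX) 1 0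
    · simpa [pullback_apply, vectorField_apply, serEta] using congr_fun₂ (H serEta) 0 0
    · simpa [pullback_apply, vectorField_apply, serEta] using congr_fun₂ (H serEta) 1 1
  · rintro ⟨H1, H2, H3⟩ p
    apply SuperSeries.ext <;>
      simp [pullback_apply, vectorField_apply, derivative_precomp, H2]
    · ring
    · linear_combination precomp φ (derivative ℂ (p 0 0)) * H1
    · linear_combination precomp φ (p 0 1) * H3 + v * precomp φ (derivative ℂ (p 0 1)) * H1

/-- Equivalence of codifferentials is change of coordinates for vector fields: the three equations
compare the images of `x` and `η`. -/
lemma equivalent_cod_iff {A B C a b c : ℂ⟦X⟧} : Equivalent (cod A B C) (cod a b c) ↔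
    ∃ φ u v h, constantCoeff φ ≠ 0 ∧ constantCoeff u ≠ 0 ∧ constantCoeff v ≠ 0 ∧
      u * precomp φ A = a * (φ + X * derivative ℂ φ) - h * c ∧
      precomp φ C = v * c ∧
      h * precomp φ (derivative ℂ C) + u * v * precomp φ B = derivative ℂ v * a + v * b := by
  constructor
  · rintro ⟨g, hg, hd⟩
    obtain ⟨φ, u, v, h, hφ, hu, hv, hG⟩ := hg.exists_dual_eq
    rw [conj_iff, hG, dual_cod, dual_cod, pullback_vectorField_eq_iff] at hd
    exact ⟨φ, u, v, h, hφ, hu, hv, hd⟩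
  · rintro ⟨φ, u, v, h, hφ, hu, hv, H⟩
    obtain ⟨g, hg, hG⟩ := exists_gradedAut h hφ hu hv
    refine ⟨g, hg, ?_⟩
    rw [conj_iff, hG, dual_cod, dual_cod, pullback_vectorField_eq_iff]
    exact H

/-- Rescaling the coordinates `θ` and `η` rescales `(a, b)` and `c` independently. -/
lemma linearlyEquivalent_cod_smul (A B C : ℂ⟦X⟧) {r s : ℂ} (hr : r ≠ 0) (hs : s ≠ 0) :
    LinearlyEquivalent (cod A B C) (cod (r • A) (r • B) (s • C)) := by
  obtain ⟨g, hg, hG⟩ := exists_gradedAut (φ := 1) (u := PowerSeries.C r) (v := PowerSeries.C s⁻¹) 0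
    (by simp) (by simpa using hr) (by simpa using hs)
  refine ⟨g, hg, ?_, ?_⟩
  · have hmon : ∀ m : Mono, g (mon m) = (r ^ (m.2.1 : ℕ) * s⁻¹ ^ (m.2.2 : ℕ)) • mon m := by
      rintro ⟨n, j, k⟩
      refine ext_pairing fun p => ?_
      have := pairing_dual (g : S →ₗ[ℂ] S) p (mon (n, j, k))
      refine this.symm.trans ?_
      rw [hG, pairing_mon, map_smul, pairing_mon]
      fin_cases j <;> fin_cases k <;>
        simp [pullback_apply, mul_assoc, ← map_mul, -map_inv₀] <;> ring
    have : LinearMap.compr₂ mul (g : S →ₗ[ℂ] S) =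
        LinearMap.compl₁₂ mul (g : S →ₗ[ℂ] S) (g : S →ₗ[ℂ] S) := by
      refine S_hom_ext fun m => S_hom_ext fun m' => ?_
      change g (mul (mon m) (mon m')) = mul (g (mon m)) (g (mon m'))
      obtain ⟨n, j, k⟩ := m
      obtain ⟨n', j', k'⟩ := m'
      simp only [hmon, map_smul, LinearMap.smul_apply, mul, onMon_mon]
      fin_cases j <;> fin_cases k <;> fin_cases j' <;> fin_cases k' <;>
        simp [mulMon, hmon, smul_smul, mul_comm]
    exact fun x y => LinearMap.congr_fun₂ this x y
  · rw [conj_iff, hG, dual_cod, dual_cod, pullback_vectorField_eq_iff]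
    refine ⟨?_, ?_, ?_⟩
    · simp [smul_eq_C_mul]
    · rw [precomp_one, smul_eq_C_mul, ← mul_assoc, ← map_mul, inv_mul_cancel₀ hs, map_one, one_mul]
    · simp only [precomp_one, derivative_C, smul_eq_C_mul]; ring

/-! ### The codifferentials of the list and their components -/

lemma cod_add (a b c a' b' c' : ℂ⟦X⟧) :
    cod a b c + cod a' b' c' = cod (a + a') (b + b') (c + c') := by
  refine LinearMap.ext fun x => ext_pairing fun p => ?_
  have : vectorField (a + a') (b + b') (c + c') p =
      vectorField a b c p + vectorField a' b' c' p := by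
    apply SuperSeries.ext <;> simp [vectorField_apply] <;> ring
  rw [LinearMap.add_apply, map_add, ← pairing_dual, ← pairing_dual, ← pairing_dual, dual_cod,
    dual_cod, dual_cod, this, map_add, LinearMap.add_apply]

lemma smul_cod (r : ℂ) (a b c : ℂ⟦X⟧) : r • cod a b c = cod (r • a) (r • b) (r • c) := by
  refine LinearMap.ext fun x => ext_pairing fun p => ?_
  have : vectorField (r • a) (r • b) (r • c) p = r • vectorField a b c p := by
    apply SuperSeries.ext <;> simp [vectorField_apply, smul_sub, smul_add]
  rw [LinearMap.smul_apply, map_smul, ← pairing_dual, ← pairing_dual, dual_cod,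
    dual_cod, this, map_smul, LinearMap.smul_apply]

lemma coder_add (f f' : S →ₗ[ℂ] S) : coder (f + f') = coder f + coder f' := by
  simp [coder, TensorProduct.map_add_left, LinearMap.add_comp, LinearMap.comp_add]

lemma coder_smul (r : ℂ) (f : S →ₗ[ℂ] S) : coder (r • f) = r • coder f := by
  simp [coder, TensorProduct.map_smul_left, LinearMap.smul_comp, LinearMap.comp_smul]

lemma psi_mon (n i : ℕ) (j₀ k₀ j k : Fin 2) (w : S) : psi (n, j₀, k₀) w (mon (i, j, k)) =
    ((i.factorial : ℂ) * coeff i (X ^ n)) • (if j = j₀ ∧ k = k₀ then w else 0) := by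
  have h : ∀ x : Fin 2, (x : ℕ).factorial = 1 := by decide
  rw [psi, onMon_mon, coeff_X_pow]
  by_cases h1 : i = n <;> by_cases h2 : j = j₀ ∧ k = k₀ <;> simp [h1, h2, h]

/-- Multiplication by `e₁` is dual to `∂_x`. -/
lemma pairing_mul_e₁ (p : SuperSeries) (m : Mono) : pairing p (mul e₁ (mon m)) =
    (m.1.factorial : ℂ) * coeff m.1 (derivative ℂ (p m.2.1 m.2.2)) := by
  obtain ⟨i, j, k⟩ := m
  have h2 : mul e₁ (mon (i, j, k)) = mon (i + 1, j, k) := by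
    rw [mul, e₁, onMon_mon, onMon_mon]
    fin_cases j <;> fin_cases k <;> simp [mulMon, add_comm]
  rw [h2, pairing_mon, coeff_derivative, Nat.factorial_succ]
  push_cast; ring

/-- Multiplication by `e₃` is dual to `∂_η`. -/
lemma pairing_mul_e₃ (p : SuperSeries) (i : ℕ) (j : Fin 2) : pairing p (mul e₃ (mon (i, j, 0))) =
    (i.factorial : ℂ) * coeff i ((-1 : ℂ) ^ (j : ℕ) • p j 1) := by
  have h2 : mul e₃ (mon (i, j, 0)) = (-1 : ℂ) ^ (j : ℕ) • mon (i, j, 1) := by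
    rw [mul, e₃, onMon_mon, onMon_mon]
    fin_cases j <;> simp [mulMon]
  rw [h2, map_smul, pairing_mon]
  simp; ring

lemma pairing_mul_e₃_of_one (p : SuperSeries) (i : ℕ) (j : Fin 2) :
    pairing p (mul e₃ (mon (i, j, 1))) = 0 := by
  rw [mul, e₃, onMon_mon, onMon_mon]
  simp [mulMon]

lemma pairing_coder (f : S →ₗ[ℂ] S) (p : SuperSeries) (m : Mono) : pairing p (coder f (mon m)) =
    ∑ n ∈ Finset.HasAntidiagonal.antidiagonal m.1, ∑ j ∈ split m.2.1, ∑ k ∈ split m.2.2,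
      ((m.1.choose n.1 : ℂ) * (-1) ^ ((k.1 : ℕ) * (j.2 : ℕ))) *
        pairing p (mul (f (mon (n.1, j.1, k.1))) (mon (n.2, j.2, k.2))) := by
  simp [coder, comul_mon, comulMon]

lemma coder_psi_e₁ (n : ℕ) : coder (psi (n, 1, 0) e₁) = cod (X ^ n) 0 0 := by
  refine dual_injective (LinearMap.ext fun p => SuperSeries.ext_pairing ?_)
  rintro ⟨N, j, k⟩
  rw [pairing_dual, pairing_coder, dual_cod, pairing_mon]
  simp only [psi_mon, map_smul, LinearMap.smul_apply, smul_eq_mul]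
  fin_cases j <;> fin_cases k <;>
    simp [split_zero, split_one, vectorField_apply, pairing_mul_e₁, mul_comm _ (X ^ n),
      ← sum_choose_mul]

lemma coder_psi_e₃ (n : ℕ) : coder (psi (n, 0, 0) e₃) = cod 0 0 (X ^ n) := by
  refine dual_injective (LinearMap.ext fun p => SuperSeries.ext_pairing ?_)
  rintro ⟨N, j, k⟩
  rw [pairing_dual, pairing_coder, dual_cod, pairing_mon]
  simp only [psi_mon, map_smul, LinearMap.smul_apply, smul_eq_mul]
  fin_cases j <;> fin_cases k <;>
    simp [split_zero, split_one, vectorField_apply, pairing_mul_e₃, pairing_mul_e₃_of_one,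
      mul_comm _ (X ^ n), ← sum_choose_mul]
  rw [← Finset.sum_neg_distrib]
  exact Finset.sum_congr rfl fun x _ => by split_ifs <;> simp

lemma coder_psi_e₃_of_odd (n : ℕ) : coder (psi (n, 1, 1) e₃) = cod 0 (X ^ n) 0 := by
  refine dual_injective (LinearMap.ext fun p => SuperSeries.ext_pairing ?_)
  rintro ⟨N, j, k⟩
  rw [pairing_dual, pairing_coder, dual_cod, pairing_mon]
  simp only [psi_mon, map_smul, LinearMap.smul_apply, smul_eq_mul]
  fin_cases j <;> fin_cases k <;>
    simp [split_zero, split_one, vectorField_apply, pairing_mul_e₃, mul_comm _ (X ^ n),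
      ← sum_choose_mul]

lemma dLine_eq (k : ℕ) (a b : ℂ) : dLine k a b = cod (a • X ^ (k - 1)) (b • X ^ (k - 2)) 0 := by
  simp [dLine, coder_add, coder_smul, coder_psi_e₁, coder_psi_e₃_of_odd, smul_cod, cod_add]

lemma dStar_eq (k : ℕ) : dStar k = cod 0 0 (X ^ k) := by
  simp [dStar, coder_psi_e₃]

lemma dPair_eq (k l : ℕ) (α : ℂ) :
    dPair k l α = cod (X ^ (l - 1) + α • X ^ (2 * l - k - 1)) (X ^ (k - 2)) 0 := by
  simp [dPair, coder_add, coder_smul, coder_psi_e₁, coder_psi_e₃_of_odd, smul_cod, cod_add]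

lemma dSharp_eq (k l : ℕ) : dSharp k l = cod (X ^ (k - 1)) ((l : ℂ) • X ^ (k - 2)) (X ^ l) := by
  simp only [dSharp, coder_add, coder_smul, coder_psi_e₁, coder_psi_e₃_of_odd, coder_psi_e₃,
    smul_cod, cod_add]
  simp

lemma dual_toW (p : SuperSeries) : dual toW p =
    ![![C (coeff 1 (p 0 0)) * X, C (constantCoeff (p 0 1))], ![C (constantCoeff (p 1 0)), 0]] := by
  refine SuperSeries.ext_pairing ?_
  rintro ⟨n, j, k⟩
  rw [pairing_dual, toW, onMon_mon, pairing_mon]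
  rcases n with _ | _ | n <;> fin_cases j <;> fin_cases k <;>
    simp [Mono.weight, pairing_mon, coeff_C, coeff_X]

lemma pairing_toW_cod (p : SuperSeries) (a b c : ℂ⟦X⟧) (m : Mono) :
    pairing p (toW (cod a b c (mon m))) =
    (m.1.factorial : ℂ) * coeff m.1 ((![![constantCoeff (p 0 1) • c, 0],
      ![coeff 1 (p 0 0) • a, constantCoeff (p 0 1) • b]] : SuperSeries) m.2.1 m.2.2) := by
  have h : vectorField a b c (dual toW p) = ![![constantCoeff (p 0 1) • c, 0],
      ![coeff 1 (p 0 0) • a, constantCoeff (p 0 1) • b]] := by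
    apply SuperSeries.ext <;> simp [dual_toW, vectorField_apply, smul_eq_C_mul, Derivation.leibniz]
  rw [← pairing_dual, ← pairing_dual, dual_cod, h, pairing_mon]

/-- The component `S^n(W) → W` of `cod a b c`: its coefficients at `e₁^(n-1) e₂`,
`e₁^(n-2) e₂ e₃` and `e₁^n`. Multiplying `a` by `x` and `b` by `x²` makes the index equal to the number
`n` of arguments, without subtraction. -/
noncomputable def weightCoeff (a b c : ℂ⟦X⟧) (n : ℕ) : ℂ × ℂ × ℂ :=
  (coeff n (X * a), coeff n (X ^ 2 * b), coeff n c)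

lemma toW_cod_eq_iff {P : ℕ → Prop} {a b c a' b' c' : ℂ⟦X⟧} :
    (∀ m : Mono, P m.weight → toW (cod a b c (mon m)) = toW (cod a' b' c' (mon m))) ↔
      ∀ n, P n → weightCoeff a b c n = weightCoeff a' b' c' n := by
  simp only [weightCoeff, Prod.mk.injEq]
  constructor
  · intro H n hn
    have hfac : ∀ i : ℕ, (i.factorial : ℂ) ≠ 0 := fun i => by exact_mod_cast i.factorial_ne_zero
    have key : ∀ i j k, Mono.weight (i, j, k) = n → ∀ p : SuperSeries, _ := fun i j k h p => by
      have := congr(pairing p $(H (i, j, k) (by rwa [h])))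
      rw [pairing_toW_cod, pairing_toW_cod] at this
      exact mul_left_cancel₀ (hfac i) this
    refine ⟨?_, ?_, ?_⟩
    · rcases n with _ | n
      · simp
      · simpa [serX, coeff_succ_X_mul] using key n 1 0 (by simp [Mono.weight]) serX
    · rcases n with _ | _ | n
      · simp [pow_two, mul_assoc]
      · simp [pow_two, mul_assoc, coeff_succ_X_mul]
      · rw [show n + 1 + 1 = n + 2 from rfl, coeff_X_pow_mul, coeff_X_pow_mul]
        simpa [serEta] using key n 1 1 (by simp [Mono.weight]) serEta
    · simpa [serEta] using key n 0 0 (by simp [Mono.weight]) serEta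
  · rintro H ⟨n, j, k⟩ hm
    refine ext_pairing fun p => ?_
    rw [pairing_toW_cod, pairing_toW_cod]
    obtain ⟨h1, h2, h3⟩ := H _ hm
    fin_cases j <;> fin_cases k <;>
      simp [Mono.weight, coeff_succ_X_mul, coeff_X_pow_mul, add_assoc] at h1 h2 h3 ⊢
    · simp [h3]
    · simp [h1]
    · simp [h2]

lemma cod_zero : cod 0 0 0 = 0 := by
  refine dual_injective (LinearMap.ext fun p => ?_)
  rw [dual_cod, dual_zero]
  apply SuperSeries.ext <;> simp [vectorField_apply]

lemma isOfDegree_cod_iff {k : ℕ} {a b c : ℂ⟦X⟧} :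
    IsOfDegree k (cod a b c) ↔ ∀ n, n ≠ k → weightCoeff a b c n = 0 := by
  have := toW_cod_eq_iff (P := (· ≠ k)) (a := a) (b := b) (c := c) (a' := 0) (b' := 0) (c' := 0)
  refine Iff.trans ?_ (this.trans ?_)
  · simp only [IsOfDegree, cod_zero, LinearMap.zero_apply, map_zero]
  · simp [weightCoeff]

lemma extends_cod_iff {k : ℕ} {a b c a' b' c' : ℂ⟦X⟧} :
    Extends k (cod a' b' c') (cod a b c) ↔
      ∀ n ≤ k, weightCoeff a b c n = weightCoeff a' b' c' n :=
  toW_cod_eq_iff (P := (· ≤ k))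

lemma cod_eq_cod_iff {a b c a' b' c' : ℂ⟦X⟧} :
    cod a b c = cod a' b' c' ↔ a = a' ∧ b = b' ∧ c = c' := by
  refine ⟨fun h => ?_, by rintro ⟨rfl, rfl, rfl⟩; rfl⟩
  have h' := congr(dual $h)
  rw [dual_cod, dual_cod] at h'
  refine ⟨?_, ?_, ?_⟩
  · simpa [vectorField_apply, serX] using congr($h' serX 1 0)
  · simpa [vectorField_apply, serEta] using congr($h' serEta 1 1)
  · simpa [vectorField_apply, serEta] using congr($h' serEta 0 0)

/-! ### The component of lowest weight -/

lemma weightCoeff_eq_zero_iff {a b c : ℂ⟦X⟧} {k : ℕ} : (∀ n < k, weightCoeff a b c n = 0) ↔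
    X ^ k ∣ X * a ∧ X ^ k ∣ X ^ 2 * b ∧ X ^ k ∣ c := by
  simp only [X_pow_dvd_iff, weightCoeff, Prod.mk_eq_zero]
  exact ⟨fun h => ⟨fun n hn => (h n hn).1, fun n hn => (h n hn).2.1, fun n hn => (h n hn).2.2⟩,
    fun h n hn => ⟨h.1 n hn, h.2.1 n hn, h.2.2 n hn⟩⟩

lemma weightCoeff_of_eq {a b c a₁ b₁ c₁ : ℂ⟦X⟧} {k : ℕ} (ha : X * a = X ^ k * a₁)
    (hb : X ^ 2 * b = X ^ k * b₁) (hc : c = X ^ k * c₁) :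
    weightCoeff a b c k = (constantCoeff a₁, constantCoeff b₁, constantCoeff c₁) := by
  simp [weightCoeff, ha, hb, hc, coeff_X_pow_mul']

/-- A change of coordinates multiplies the component of lowest weight by nonzero factors, one for
`(a, b)` and one for `c`. -/
lemma leading_of_equivalent {A B C a b c : ℂ⟦X⟧} {k : ℕ} (he : Equivalent (cod A B C) (cod a b c))
    (hk : ∀ n < k, weightCoeff A B C n = 0) :
    (∀ n < k, weightCoeff a b c n = 0) ∧ ∃ r s : ℂ, r ≠ 0 ∧ s ≠ 0 ∧
      weightCoeff a b c k = (r * (weightCoeff A B C k).1, r * (weightCoeff A B C k).2.1,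
        s * (weightCoeff A B C k).2.2) := by
  obtain ⟨φ, u, v, h, hφ, hu, hv, E1, E2, E3⟩ := equivalent_cod_iff.1 he
  obtain ⟨⟨A₁, hA⟩, ⟨B₁, hB⟩, ⟨C₁, hC⟩⟩ := weightCoeff_eq_zero_iff.1 hk
  have iφ := PowerSeries.mul_inv_cancel φ hφ
  have iv := PowerSeries.mul_inv_cancel v hv
  set w := φ + X * derivative ℂ φ with hw
  have hw0 : constantCoeff w = constantCoeff φ := by simp [hw]
  have iw := PowerSeries.mul_inv_cancel w (by rwa [hw0])
  have hA' : X * φ * precomp φ A = X ^ k * φ ^ k * precomp φ A₁ := by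
    simpa [mul_pow] using congr(precomp φ $hA)
  have hB' : (X * φ) ^ 2 * precomp φ B = X ^ k * φ ^ k * precomp φ B₁ := by
    simpa [mul_pow] using congr(precomp φ $hB)
  have hC' : precomp φ C = X ^ k * φ ^ k * precomp φ C₁ := by
    simpa [mul_pow] using congr(precomp φ $hC)
  obtain ⟨C₂, hC₂⟩ : ∃ C₂, X * derivative ℂ C = X ^ k * C₂ := by
    refine ⟨(k : ℂ⟦X⟧) * C₁ + X * derivative ℂ C₁, ?_⟩
    rw [hC]
    rcases k with _ | k
    · simp
    · simp only [Derivation.leibniz, Derivation.leibniz_pow, derivative_X, smul_eq_mul,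
        nsmul_eq_mul]
      simp; ring
  have hC₂' : X * φ * precomp φ (derivative ℂ C) = X ^ k * φ ^ k * precomp φ C₂ := by
    simpa [mul_pow] using congr(precomp φ $hC₂)
  have hc : c = X ^ k * (v⁻¹ * φ ^ k * precomp φ C₁) := by
    linear_combination (-c) * iv - v⁻¹ * E2 + v⁻¹ * hC'
  set c₁ := v⁻¹ * φ ^ k * precomp φ C₁ with hc₁
  have ha : X * a = X ^ k * (φ⁻¹ * w⁻¹ * (u * φ ^ k * precomp φ A₁ + X * φ * h * c₁)) := by
    linear_combination (-X * a) * iw + (-X * a * w * w⁻¹) * iφ - X * φ * φ⁻¹ * w⁻¹ * E1 +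
      φ⁻¹ * w⁻¹ * u * hA' + X * φ * h * φ⁻¹ * w⁻¹ * hc
  set a₁ := φ⁻¹ * w⁻¹ * (u * φ ^ k * precomp φ A₁ + X * φ * h * c₁) with ha₁
  have hb : X ^ 2 * b = X ^ k * (φ⁻¹ ^ 2 * v⁻¹ * (h * (X * φ) * φ ^ k * precomp φ C₂ +
      u * v * φ ^ k * precomp φ B₁ - derivative ℂ v * φ ^ 2 * X * a₁)) := by
    linear_combination (-X ^ 2 * b) * iv + (-X ^ 2 * b * v * v⁻¹) * (φ * φ⁻¹ + 1) * iφ +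
      φ⁻¹ ^ 2 * v⁻¹ * (-X ^ 2 * φ ^ 2 * E3 + u * v * hB' + h * X * φ * hC₂' -
        derivative ℂ v * φ ^ 2 * X * ha)
  refine ⟨weightCoeff_eq_zero_iff.2 ⟨⟨_, ha⟩, ⟨_, hb⟩, ⟨_, hc⟩⟩,
    (constantCoeff φ)⁻¹ ^ 2 * constantCoeff u * constantCoeff φ ^ k,
    (constantCoeff v)⁻¹ * constantCoeff φ ^ k, ?_, ?_, ?_⟩
  · positivity
  · positivity
  · rw [weightCoeff_of_eq ha hb hc, weightCoeff_of_eq hA hB hC]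
    simp only [Prod.mk.injEq]
    refine ⟨?_, ?_, ?_⟩
    · simp [ha₁, hw0]; ring
    · simp; field_simp
    · simp [hc₁]

/-- Equivalent codifferentials have the same lowest weight, and their components of that weight
agree up to nonzero factors. -/
lemma leading_unique {A B C a b c : ℂ⟦X⟧} {k k' : ℕ} (he : Equivalent (cod A B C) (cod a b c))
    (hk : ∀ n < k, weightCoeff A B C n = 0) (hk0 : weightCoeff A B C k ≠ 0)
    (hk' : ∀ n < k', weightCoeff a b c n = 0) (hk0' : weightCoeff a b c k' ≠ 0) :
    k = k' ∧ ∃ r s : ℂ, r ≠ 0 ∧ s ≠ 0 ∧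
      weightCoeff a b c k' = (r * (weightCoeff A B C k).1, r * (weightCoeff A B C k).2.1,
        s * (weightCoeff A B C k).2.2) := by
  have h1 := leading_of_equivalent he hk
  have h2 := leading_of_equivalent he.symm hk'
  obtain rfl : k = k' := by
    rcases lt_trichotomy k k' with h | h | h
    · exact absurd (h2.1 k h) hk0
    · exact h
    · exact absurd (h1.1 k' h) hk0'
  exact ⟨rfl, h1.2⟩

/-! ### Homogeneous coordinates -/

lemma exists_hasCoords (P : ℙ ℂ (Fin 2 → ℂ)) : ∃ a b, HasCoords P a b := by
  induction P using Projectivization.ind with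
  | h v hv =>
    have : v = ![v 0, v 1] := by ext i; fin_cases i <;> rfl
    exact ⟨v 0, v 1, this ▸ hv, by congr⟩

lemma hasCoords_mk {a b : ℂ} (h : a ≠ 0 ∨ b ≠ 0) : ∃ P, HasCoords P a b := by
  have : ![a, b] ≠ 0 := by
    intro h0
    have h1 := congr_fun h0 0
    have h2 := congr_fun h0 1
    simp at h1 h2
    tauto
  exact ⟨_, this, rfl⟩

lemma HasCoords.ne_zero {P : ℙ ℂ (Fin 2 → ℂ)} {a b : ℂ} (h : HasCoords P a b) : a ≠ 0 ∨ b ≠ 0 := by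
  obtain ⟨h, -⟩ := h
  by_contra! h0
  exact h (by simp [h0.1, h0.2])

lemma HasCoords.exists_smul {P : ℙ ℂ (Fin 2 → ℂ)} {a b a' b' : ℂ} (h : HasCoords P a b)
    (h' : HasCoords P a' b') : ∃ r : ℂ, r ≠ 0 ∧ a' = r * a ∧ b' = r * b := by
  have hne := h'.ne_zero
  obtain ⟨h, rfl⟩ := h
  obtain ⟨h', e⟩ := h'
  obtain ⟨r, hr⟩ := (Projectivization.mk_eq_mk_iff' ℂ _ _ h' h).1 e.symm
  have h1 := congr_fun hr 0
  have h2 := congr_fun hr 1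
  simp at h1 h2
  refine ⟨r, ?_, h1.symm, h2.symm⟩
  rintro rfl
  simp at h1 h2
  rcases hne with h | h <;> exact h (by simp [← h1, ← h2])

lemma HasCoords.eq_of_smul {P P' : ℙ ℂ (Fin 2 → ℂ)} {a b r : ℂ} (h : HasCoords P a b)
    (h' : HasCoords P' (r * a) (r * b)) : P = P' := by
  obtain ⟨h, rfl⟩ := h
  obtain ⟨h', rfl⟩ := h'
  rw [eq_comm, Projectivization.mk_eq_mk_iff']
  exact ⟨r, by ext i; fin_cases i <;> simp⟩

/-! ### Labels of components of lowest weight -/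

/-- The triple `t` is the weight `n` component of a codifferential with label `L`, where `L` is the
label of a codifferential of fixed degree `n`. -/
def Label.LeadTriple : Label → ℕ → ℂ × ℂ × ℂ → Prop
  | .line k P, n, t => n = k ∧ HasCoords P t.1 t.2.1 ∧ t.2.2 = 0
  | .star k, n, t => n = k ∧ t = (0, 0, 1)
  | .pair _ _ _, _, _ => False
  | .sharp k l, n, t => n = k ∧ l = k ∧ t = (1, (k : ℂ), 1)

/-- The component of lowest weight of `d` is that of a codifferential of fixed degree with label
`L`. -/
def HasLead (L : Label) (d : S →ₗ[ℂ] S) : Prop :=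
  ∃ k a b c, d = cod a b c ∧ (∀ n < k, weightCoeff a b c n = 0) ∧
    L.LeadTriple k (weightCoeff a b c k)

lemma Label.LeadTriple.ne_zero {L : Label} {n : ℕ} {t : ℂ × ℂ × ℂ} (h : L.LeadTriple n t) :
    t ≠ 0 := by
  rintro rfl
  cases L with
  | line k P => rcases h.2.1.ne_zero with h | h <;> exact h rfl
  | star k => simpa [Prod.ext_iff] using h.2
  | pair => exact h
  | sharp k l => simpa [Prod.ext_iff] using h.2.2

/-- The label of the component of lowest weight is an invariant of equivalence. -/
lemma HasLead.eq {L L' : Label} {d d' : S →ₗ[ℂ] S} (h : HasLead L d) (h' : HasLead L' d')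
    (he : Equivalent d d') : L = L' := by
  obtain ⟨k, a, b, c, rfl, hk, hL⟩ := h
  obtain ⟨k', a', b', c', rfl, hk', hL'⟩ := h'
  obtain ⟨rfl, r, s, hr, hs, ht⟩ := leading_unique he hk hL.ne_zero hk' hL'.ne_zero
  rw [ht] at hL'
  set t := weightCoeff a b c k
  obtain ⟨α, β, γ⟩ := t
  cases L with
  | line m P =>
    obtain ⟨rfl, hP, h0⟩ := hL
    simp only at h0 hP
    subst h0
    cases L' with
    | line m' P' =>
      obtain ⟨rfl, hP', -⟩ := hL'
      rw [hP.eq_of_smul hP']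
    | star m' => simpa using hL'.2
    | pair => exact hL'.elim
    | sharp m' l => simpa using hL'.2.2
  | star m =>
    obtain ⟨rfl, h0⟩ := hL
    simp only [Prod.mk.injEq] at h0
    obtain ⟨rfl, rfl, rfl⟩ := h0
    cases L' with
    | line m' P' => exact absurd hL'.2.2 (by simpa using hs)
    | star m' => rw [hL'.1]
    | pair => exact hL'.elim
    | sharp m' l => simpa using hL'.2.2
  | pair => exact hL.elim
  | sharp m l =>
    obtain ⟨rfl, rfl, h0⟩ := hL
    simp only [Prod.mk.injEq] at h0
    obtain ⟨rfl, rfl, rfl⟩ := h0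
    cases L' with
    | line m' P' => exact absurd hL'.2.2 (by simpa using hs)
    | star m' => exact absurd hL'.2 (by simp [hr])
    | pair => exact hL'.elim
    | sharp m' l =>
      obtain ⟨rfl, rfl, -⟩ := hL'
      rfl

/-- `L.IsLeadOf N`: the codifferentials with label `N` have a component of lowest weight with
label `L`. -/
def Label.IsLeadOf (L : Label) : Label → Prop
  | .line k P => L = .line k P
  | .star k => L = .star k
  | .pair k _ _ => ∃ P, HasCoords P 0 1 ∧ L = .line k P
  | .sharp k l => (l = k ∧ L = .sharp k k) ∨ (k < l ∧ ∃ P, HasCoords P 1 l ∧ L = .line k P)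

lemma X_mul_X_pow_pred {k : ℕ} (hk : 1 ≤ k) : (X : ℂ⟦X⟧) * X ^ (k - 1) = X ^ k := by
  rw [← pow_succ']; congr 1; omega

lemma X_sq_mul_X_pow {k : ℕ} (hk : 2 ≤ k) : (X : ℂ⟦X⟧) ^ 2 * X ^ (k - 2) = X ^ k := by
  rw [← pow_add]; congr 1; omega

lemma HasCoords.snd_eq_zero {P : ℙ ℂ (Fin 2 → ℂ)} {a b : ℂ} (h : HasCoords P 1 0)
    (h' : HasCoords P a b) :
    b = 0 := by
  obtain ⟨r, -, -, h⟩ := h.exists_smul h'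
  simpa using h

lemma Label.Valid.exists_lead {N : Label} (hN : N.Valid) {d : S →ₗ[ℂ] S} (hd : d ∈ N.codiffs) :
    ∃ L : Label, L.IsLeadOf N ∧ HasLead L d := by
  cases N with
  | line k P =>
    obtain ⟨a, b, hP, rfl⟩ := hd
    have hk : 1 ≤ k := by rcases hN with h | ⟨h, -⟩ <;> omega
    have ha : X * (a • X ^ (k - 1)) = X ^ k * (C a : ℂ⟦X⟧) := by
      rw [smul_eq_C_mul, ← X_mul_X_pow_pred hk]; ring
    have hb : X ^ 2 * (b • X ^ (k - 2)) = X ^ k * (C b : ℂ⟦X⟧) := by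
      rcases hN with h | ⟨h, h'⟩
      · rw [smul_eq_C_mul, ← X_sq_mul_X_pow h]; ring
      · rw [h'.snd_eq_zero hP]; simp
    have hc : (0 : ℂ⟦X⟧) = X ^ k * 0 := by simp
    refine ⟨.line k P, rfl, k, _, _, _, dLine_eq k a b,
      weightCoeff_eq_zero_iff.2 ⟨⟨_, ha⟩, ⟨_, hb⟩, ⟨_, hc⟩⟩, rfl, ?_, ?_⟩
    · rw [weightCoeff_of_eq ha hb hc]; simpa using hP
    · rw [weightCoeff_of_eq ha hb hc]; simp
  | star k =>
    rw [show d = dStar k from hd]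
    have ha : X * (0 : ℂ⟦X⟧) = X ^ k * 0 := by simp
    have hb : X ^ 2 * (0 : ℂ⟦X⟧) = X ^ k * 0 := by simp
    have hc : X ^ k = X ^ k * (1 : ℂ⟦X⟧) := by simp
    refine ⟨.star k, rfl, k, _, _, _, dStar_eq k,
      weightCoeff_eq_zero_iff.2 ⟨⟨_, ha⟩, ⟨_, hb⟩, ⟨_, hc⟩⟩, rfl, ?_⟩
    rw [weightCoeff_of_eq ha hb hc]; simp
  | pair k l α =>
    rw [show d = dPair k l α from hd]
    obtain ⟨hk, hl⟩ := hN
    have ha : X * (X ^ (l - 1) + α • X ^ (2 * l - k - 1)) =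
        X ^ k * (X ^ (l - k) + C α * X ^ (2 * (l - k)) : ℂ⟦X⟧) := by
      have h1 : (X : ℂ⟦X⟧) * X ^ (l - 1) = X ^ k * X ^ (l - k) := by
        rw [← pow_succ', ← pow_add]; congr 1; omega
      have h2 : (X : ℂ⟦X⟧) * X ^ (2 * l - k - 1) = X ^ k * X ^ (2 * (l - k)) := by
        rw [← pow_succ', ← pow_add]; congr 1; omega
      rw [smul_eq_C_mul]
      linear_combination h1 + C α * h2
    have hb : X ^ 2 * X ^ (k - 2) = X ^ k * (1 : ℂ⟦X⟧) := by rw [X_sq_mul_X_pow hk, mul_one]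
    have hc : (0 : ℂ⟦X⟧) = X ^ k * 0 := by simp
    obtain ⟨P, hP⟩ := hasCoords_mk (a := 0) (b := 1) (by simp)
    have hne : l - k ≠ 0 := by omega
    refine ⟨.line k P, ⟨P, hP, rfl⟩, k, _, _, _, dPair_eq k l α,
      weightCoeff_eq_zero_iff.2 ⟨⟨_, ha⟩, ⟨_, hb⟩, ⟨_, hc⟩⟩, rfl, ?_, ?_⟩
    · rw [weightCoeff_of_eq ha hb hc]; simpa [hne] using hP
    · rw [weightCoeff_of_eq ha hb hc]; simp
  | sharp k l =>
    rw [show d = dSharp k l from hd]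
    obtain ⟨hk, hl⟩ := hN
    have ha : X * X ^ (k - 1) = X ^ k * (1 : ℂ⟦X⟧) := by
      rw [X_mul_X_pow_pred (by omega), mul_one]
    have hb : X ^ 2 * ((l : ℂ) • X ^ (k - 2)) = X ^ k * (C (l : ℂ) : ℂ⟦X⟧) := by
      rw [smul_eq_C_mul, ← X_sq_mul_X_pow hk]; ring
    have hc : X ^ l = X ^ k * (X ^ (l - k) : ℂ⟦X⟧) := by
      rw [← pow_add]; congr 1; omega
    have H := weightCoeff_eq_zero_iff.2 ⟨⟨_, ha⟩, ⟨_, hb⟩, ⟨_, hc⟩⟩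
    have H' := weightCoeff_of_eq ha hb hc
    rcases hl.eq_or_lt with rfl | hlt
    · refine ⟨.sharp k k, Or.inl ⟨rfl, rfl⟩, k, _, _, _, dSharp_eq k k, H, rfl, rfl, ?_⟩
      rw [H']; simp
    · obtain ⟨P, hP⟩ := hasCoords_mk (a := 1) (b := (l : ℂ)) (by simp)
      have hne : l - k ≠ 0 := by omega
      refine ⟨.line k P, Or.inr ⟨hlt, P, hP, rfl⟩, k, _, _, _, dSharp_eq k l, H, rfl, ?_, ?_⟩
      · rw [H']; simpa using hP
      · rw [H']; simp [hne]

/-! ### Uniqueness of the label -/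

/-- The coefficient of `x^n` in `n w - x w'` vanishes: an exact differential has no residue. -/
lemma coeff_sub_X_mul_derivative (n : ℕ) (w : ℂ⟦X⟧) (m : ℕ) :
    coeff m ((n : ℂ) • w - X * derivative ℂ w) = ((n : ℂ) - m) * coeff m w := by
  rcases m with _ | m
  · simp
  · rw [map_sub, coeff_succ_X_mul, coeff_derivative]
    simp; ring

lemma eq_of_X_pow_mul_eq {m n : ℕ} {p q : ℂ⟦X⟧} (h : X ^ m * p = X ^ n * q)
    (hp : constantCoeff p ≠ 0) (hq : constantCoeff q ≠ 0) : m = n := by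
  by_contra hne
  rcases Nat.lt_or_gt_of_ne hne with hlt | hlt
  · have := congr(coeff m $h)
    rw [coeff_X_pow_mul', coeff_X_pow_mul', if_pos le_rfl, if_neg (by omega)] at this
    simp [hp] at this
  · have := congr(coeff n $h)
    rw [coeff_X_pow_mul', coeff_X_pow_mul', if_neg (by omega), if_pos le_rfl] at this
    simp [hq.symm] at this

/-- The coefficient of `θ ∂_x` in `d_{k,l}(α)`. -/
lemma pair_series_eq {k l : ℕ} (hkl : k < l) (α : ℂ) :
    (X ^ (l - 1) + α • X ^ (2 * l - k - 1) : ℂ⟦X⟧) =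
      X ^ (l - 1) * (1 + C α * X ^ (l - k)) := by
  have h : 2 * l - k - 1 = (l - 1) + (l - k) := by omega
  rw [smul_eq_C_mul, h, pow_add]; ring

/-- The residue of the form `dx / (x^(n+1) (1 + α x^n))` does not change under substitution of
`x φ(x)`, nor under addition of a form without pole; hence `α` is an invariant. -/
lemma residue_eq {n : ℕ} (hn : n ≠ 0) {α α' : ℂ} {φ : ℂ⟦X⟧} (hφ : constantCoeff φ ≠ 0)
    (h : X ^ (n + 1) ∣ φ ^ (n + 1) * (1 + C α * X ^ n * φ ^ n) -
      (1 + C α' * X ^ n) * (φ + X * derivative ℂ φ)) : α = α' := by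
  have iφ := PowerSeries.mul_inv_cancel φ hφ
  set ψ := φ⁻¹ with hψ
  set y : ℂ⟦X⟧ := (n : ℂ) • ψ ^ n - X * derivative ℂ (ψ ^ n) with hy
  have hdψ : derivative ℂ ψ = - ψ ^ 2 * derivative ℂ φ := derivative_inv' φ
  have hdw : derivative ℂ (ψ ^ n) = - C (n : ℂ) * ψ ^ (n + 1) * derivative ℂ φ := by
    obtain ⟨n, rfl⟩ := Nat.exists_eq_succ_of_ne_zero hn
    rw [Derivation.leibniz_pow, hdψ]
    simp; ring
  have ipow : ψ ^ (n + 1) * φ ^ (n + 1) = 1 := by rw [← mul_pow, mul_comm, iφ, one_pow]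
  have hy' : y = C (n : ℂ) * ψ ^ (n + 1) * (φ + X * derivative ℂ φ) := by
    rw [hy, hdw, smul_eq_C_mul]
    linear_combination (- C (n : ℂ) * ψ ^ n) * iφ
  -- `y = n w - x w'` for `w = φ ^ (-n)` has no term of degree `n`
  have hdvd : X ^ (n + 1) ∣ C (n : ℂ) * (1 + C α * X ^ n * φ ^ n) - (1 + C α' * X ^ n) * y := by
    obtain ⟨q, hq⟩ := h
    refine ⟨C (n : ℂ) * ψ ^ (n + 1) * q, ?_⟩
    rw [hy']
    linear_combination C (n : ℂ) * ψ ^ (n + 1) * hq - C (n : ℂ) * (1 + C α * X ^ n * φ ^ n) * ipow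
  rw [X_pow_dvd_iff] at hdvd
  have hn' : (n : ℂ) ≠ 0 := by exact_mod_cast hn
  have h0 := hdvd 0 (by omega)
  have hn1 := hdvd n (by omega)
  have y0 : constantCoeff y = n * constantCoeff (ψ ^ n) := by
    have := coeff_sub_X_mul_derivative n (ψ ^ n) 0
    rw [← hy] at this
    simpa using this
  have yn : coeff n y = 0 := by
    have := coeff_sub_X_mul_derivative n (ψ ^ n) n
    rw [← hy] at this
    simpa using this
  have hψn : constantCoeff ψ ^ n = 1 := by
    simp [hn, y0] at h0
    apply mul_left_cancel₀ hn'; linear_combination -h0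
  have hφn : constantCoeff φ ^ n = 1 := by
    have h1 := congr(constantCoeff ($iφ) ^ n)
    simpa [mul_pow, hψn] using h1
  have e1 : coeff n (C (n : ℂ) * (1 + C α * X ^ n * φ ^ n)) = n * α := by
    have : C (n : ℂ) * (1 + C α * X ^ n * φ ^ n) =
        C (n : ℂ) + X ^ n * (C (n : ℂ) * C α * φ ^ n) := by
      ring
    rw [this, map_add, coeff_X_pow_mul', if_pos le_rfl]
    rw [coeff_C, if_neg hn]
    simp [hφn]
  have e2 : coeff n ((1 + C α' * X ^ n) * y) = α' * n := by
    have : (1 + C α' * X ^ n) * y = y + X ^ n * (C α' * y) := by ring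
    rw [this, map_add, yn, coeff_X_pow_mul', if_pos le_rfl]
    simp [y0, hψn]
  rw [map_sub, e1, e2] at hn1
  apply mul_left_cancel₀ hn'
  linear_combination hn1

/-- Dividing the equation for `a` by the one for `b` eliminates `u`, and leaves the comparison of
residues. -/
lemma dPair_injective {k l l' : ℕ} {α α' : ℂ} (hk : 2 ≤ k) (hl : k < l) (hl' : k < l')
    (he : Equivalent (dPair k l α) (dPair k l' α')) : l = l' ∧ α = α' := by
  rw [dPair_eq, dPair_eq, equivalent_cod_iff, pair_series_eq hl, pair_series_eq hl'] at he
  obtain ⟨φ, u, v, h, hφ, hu, hv, E1, -, E3⟩ := he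
  have hne : l - k ≠ 0 := by omega
  have hne' : l' - k ≠ 0 := by omega
  simp only [map_mul, map_pow, map_add, map_one, precomp_X, precomp_C, mul_zero, sub_zero,
    map_zero, zero_add] at E1 E3
  have E1' : X ^ (l - 1) * (u * φ ^ (l - 1) * (1 + C α * (X * φ) ^ (l - k))) =
      X ^ (l' - 1) * ((1 + C α' * X ^ (l' - k)) * (φ + X * derivative ℂ φ)) := by
    linear_combination E1
  have hll : l - 1 = l' - 1 := eq_of_X_pow_mul_eq E1' (by simp [hne, hu, hφ]) (by simp [hne', hφ])
  obtain rfl : l = l' := by omega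
  refine ⟨rfl, residue_eq hne hφ ?_⟩
  obtain ⟨n, rfl⟩ : ∃ n, l = k + n := ⟨l - k, by omega⟩
  obtain ⟨k, rfl⟩ : ∃ k', k = k' + 2 := ⟨k - 2, by omega⟩
  have i1 : k + 2 + n - 1 = k + (n + 1) := by omega
  have i2 : k + 2 + n - (k + 2) = n := by omega
  rw [i1, i2] at E1'
  rw [i1, i2] at E3
  rw [i2]
  simp only [Nat.add_sub_cancel] at E3
  have F1 := mul_left_cancel₀ (pow_ne_zero _ X_ne_zero) E1'
  have F3 : u * v * φ ^ k = v + X ^ (n + 1) * (derivative ℂ v * (1 + C α' * X ^ n)) := by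
    apply mul_left_cancel₀ (pow_ne_zero k X_ne_zero)
    linear_combination E3
  have iv := PowerSeries.mul_inv_cancel v hv
  refine ⟨- v⁻¹ * (derivative ℂ v * (1 + C α' * X ^ n)) * φ ^ (n + 1) *
    (1 + C α * X ^ n * φ ^ n), ?_⟩
  linear_combination v⁻¹ * v * F1 - v⁻¹ * φ ^ (n + 1) * (1 + C α * X ^ n * φ ^ n) * F3 -
    (φ ^ (n + 1) * (1 + C α * X ^ n * φ ^ n) - (1 + C α' * X ^ n) * (φ + X * derivative ℂ φ)) * iv

/-- The condition `a = 0` is invariant among codifferentials with `c = 0`. -/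
lemma eq_zero_of_equivalent_left {B a b : ℂ⟦X⟧} (he : Equivalent (cod 0 B 0) (cod a b 0)) :
    a = 0 := by
  obtain ⟨φ, u, v, h, hφ, hu, hv, E1, -, -⟩ := equivalent_cod_iff.1 he
  have hw : φ + X * derivative ℂ φ ≠ 0 := fun h0 => hφ (by simpa using congr(constantCoeff $h0))
  have : a * (φ + X * derivative ℂ φ) = 0 := by simpa using E1.symm
  exact (mul_eq_zero.1 this).resolve_right hw

/-- The condition `c = 0` is invariant. -/
lemma eq_zero_of_equivalent_right {A B a b c : ℂ⟦X⟧} (he : Equivalent (cod A B 0) (cod a b c)) :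
    c = 0 := by
  obtain ⟨φ, u, v, h, hφ, hu, hv, -, E2, -⟩ := equivalent_cod_iff.1 he
  have hw : v ≠ 0 := fun h0 => hv (by simp [h0])
  have : v * c = 0 := by simpa using E2.symm
  exact (mul_eq_zero.1 this).resolve_left hw

lemma not_equivalent_line_pair {k k' l : ℕ} {P : ℙ ℂ (Fin 2 → ℂ)} {α a b : ℂ} (hP : HasCoords P 0 1)
    (hab : HasCoords P a b) (hl : k' < l) : ¬ Equivalent (dLine k a b) (dPair k' l α) := by
  intro he
  obtain ⟨r, -, ha, -⟩ := hP.exists_smul hab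
  rw [dLine_eq, dPair_eq, ha, mul_zero, zero_smul, pair_series_eq hl] at he
  have := eq_zero_of_equivalent_left he
  rw [mul_eq_zero, or_iff_right (pow_ne_zero _ X_ne_zero)] at this
  have hne : l - k' ≠ 0 := by omega
  simpa [hne] using congr(constantCoeff $this)

lemma not_equivalent_line_sharp {k k' l : ℕ} {a b : ℂ} :
    ¬ Equivalent (dLine k a b) (dSharp k' l) := by
  intro he
  rw [dLine_eq, dSharp_eq] at he
  exact pow_ne_zero _ X_ne_zero (eq_zero_of_equivalent_right he)

lemma HasCoords.cast_unique {P : ℙ ℂ (Fin 2 → ℂ)} {l l' : ℕ} (h : HasCoords P 1 l)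
    (h' : HasCoords P 1 l') : l = l' := by
  obtain ⟨r, -, h1, h2⟩ := h.exists_smul h'
  rw [mul_one] at h1
  rw [← h1, one_mul] at h2
  exact_mod_cast h2.symm

lemma HasCoords.false_of_zero_of_one {P : ℙ ℂ (Fin 2 → ℂ)} {b b' : ℂ} (h : HasCoords P 0 b)
    (h' : HasCoords P 1 b') : False := by
  obtain ⟨r, -, h1, -⟩ := h.exists_smul h'
  simp at h1

lemma Label.eq_of_equivalent {N N' : Label} (hN : N.Valid) (hN' : N'.Valid) {d d' : S →ₗ[ℂ] S}
    (hd : d ∈ N.codiffs) (hd' : d' ∈ N'.codiffs) (he : Equivalent d d') : N = N' := by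
  obtain ⟨L, hL, hLd⟩ := hN.exists_lead hd
  obtain ⟨L', hL', hLd'⟩ := hN'.exists_lead hd'
  obtain rfl := hLd.eq hLd' he
  cases N with
  | line k P =>
    obtain ⟨a, b, hab, rfl⟩ := hd
    cases hL
    cases N' with
    | line k' P' => exact hL'
    | star k' => exact hL'
    | pair k' l' α' =>
      obtain ⟨P', hP', e⟩ := hL'
      cases e
      obtain rfl : d' = dPair _ l' α' := hd'
      exact absurd he (not_equivalent_line_pair hP' hab hN'.2)
    | sharp k' l' =>
      obtain rfl : d' = dSharp k' l' := hd'
      exact absurd he not_equivalent_line_sharp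
  | star k =>
    cases hL
    cases N' with
    | line k' P' => cases hL'
    | star k' => exact hL'
    | pair k' l' α' => obtain ⟨P', -, e⟩ := hL'; cases e
    | sharp k' l' => rcases hL' with ⟨-, e⟩ | ⟨-, _, -, e⟩ <;> cases e
  | pair k l α =>
    obtain rfl : d = dPair k l α := hd
    obtain ⟨P, hP, rfl⟩ := hL
    cases N' with
    | line k' P' =>
      obtain ⟨a, b, hab, rfl⟩ := hd'
      cases hL'
      exact absurd he.symm (not_equivalent_line_pair hP hab hN.2)
    | star k' => cases hL'
    | pair k' l' α' =>
      obtain ⟨P', hP', e⟩ := hL'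
      cases e
      obtain rfl : d' = dPair k l' α' := hd'
      obtain ⟨rfl, rfl⟩ := dPair_injective hN.1 hN.2 hN'.2 he
      rfl
    | sharp k' l' =>
      rcases hL' with ⟨-, e⟩ | ⟨-, P', hP', e⟩
      · cases e
      · cases e
        exact (hP.false_of_zero_of_one hP').elim
  | sharp k l =>
    obtain rfl : d = dSharp k l := hd
    cases N' with
    | line k' P' =>
      obtain ⟨a, b, hab, rfl⟩ := hd'
      exact absurd he.symm not_equivalent_line_sharp
    | star k' =>
      rcases hL with ⟨-, rfl⟩ | ⟨-, P, hP, rfl⟩ <;> cases hL'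
    | pair k' l' α' =>
      obtain ⟨P', hP', e⟩ := hL'
      rcases hL with ⟨-, rfl⟩ | ⟨-, P, hP, rfl⟩
      · cases e
      · cases e
        exact (hP'.false_of_zero_of_one hP).elim
    | sharp k' l' =>
      rcases hL with ⟨rfl, rfl⟩ | ⟨-, P, hP, rfl⟩
      · rcases hL' with ⟨rfl, e⟩ | ⟨-, P', hP', e⟩ <;> cases e
        rfl
      · rcases hL' with ⟨rfl, e⟩ | ⟨-, P', hP', e⟩ <;> cases e
        rw [hP.cast_unique hP']

/-! ### Differential equations and roots of power series -/

/-- The equation `v' = v g` has the solution `v = exp (∫ g)`. -/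
lemma exists_derivative_eq (g : ℂ⟦X⟧) : ∃ v, constantCoeff v = 1 ∧ derivative ℂ v = v * g := by
  set φ : ℂ⟦X⟧ := PowerSeries.mk fun n => coeff n g / (n + 1) with hφ
  have h : φ + X * derivative ℂ φ = g := by
    rw [← derivative_X_mul]
    ext n
    have : (n + 1 : ℂ) ≠ 0 := by exact_mod_cast n.succ_ne_zero
    rw [coeff_derivative, coeff_succ_X_mul, hφ, coeff_mk]
    field_simp
  refine ⟨precomp φ (exp ℂ), by simp, ?_⟩
  rw [derivative_precomp, h, derivative_exp]

/-- Unit power series have `n`-th roots. -/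
lemma exists_pow_mul_eq_one {n : ℕ} (hn : n ≠ 0) {w : ℂ⟦X⟧} (hw : constantCoeff w ≠ 0) :
    ∃ φ : ℂ⟦X⟧, φ ^ n * w = 1 := by
  have hn' : (n : ℂ) ≠ 0 := by exact_mod_cast hn
  obtain ⟨v, hv0, hv⟩ := exists_derivative_eq (- C (n : ℂ)⁻¹ * w⁻¹ * derivative ℂ w)
  have iw := PowerSeries.mul_inv_cancel w hw
  have iN : C (n : ℂ) * C (n : ℂ)⁻¹ = (1 : ℂ⟦X⟧) := by rw [← map_mul, mul_inv_cancel₀ hn', map_one]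
  have h1 : v ^ n * w = C (constantCoeff w) := by
    refine derivative.ext ?_ (by simp [hv0])
    rw [Derivation.leibniz, Derivation.leibniz_pow, hv, derivative_C]
    obtain ⟨m, rfl⟩ := Nat.exists_eq_succ_of_ne_zero hn
    simp only [smul_eq_mul, nsmul_eq_mul, Nat.succ_eq_add_one, Nat.add_sub_cancel]
    have : ((m + 1 : ℕ) : ℂ⟦X⟧) = C ((m + 1 : ℕ) : ℂ) := by simp
    rw [this]
    linear_combination (- v ^ (m + 1) * derivative ℂ w * w * w⁻¹) * iN -
      v ^ (m + 1) * derivative ℂ w * iw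
  obtain ⟨r, hr⟩ := IsAlgClosed.exists_pow_nat_eq (constantCoeff w)⁻¹ (Nat.pos_of_ne_zero hn)
  refine ⟨C r * v, ?_⟩
  rw [mul_pow, mul_assoc, h1, ← map_pow, hr, ← map_mul, inv_mul_cancel₀ hw, map_one]

lemma exists_X_pow_mul {p : ℂ⟦X⟧} (hp : p ≠ 0) : ∃ n q, p = X ^ n * q ∧ constantCoeff q ≠ 0 :=
  ⟨_, _, X_pow_order_mul_divXPowOrder.symm, by
    rwa [Ne, constantCoeff_divXPowOrder_eq_zero_iff]⟩

/-! ### Existence of the label -/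

/-- Equivalence by a change of coordinates that fixes `x` modulo `θη`. -/
lemma equivalent_cod_of_eq {A B C a b c : ℂ⟦X⟧} {u v : ℂ⟦X⟧} (h : ℂ⟦X⟧) (hu : constantCoeff u ≠ 0)
    (hv : constantCoeff v ≠ 0) (E1 : u * A = a - h * c) (E2 : C = v * c)
    (E3 : h * derivative ℂ C + u * v * B = derivative ℂ v * a + v * b) :
    Equivalent (cod A B C) (cod a b c) :=
  equivalent_cod_iff.2 ⟨1, u, v, h, by simp, hu, hv, by simpa using E1, by simpa using E2,
    by simpa using E3⟩

/-- If `c ≠ 0`, then `b = a c' / c` is determined by `a` and `c`, so that the third equation of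
`equivalent_cod_iff` follows from the first two. -/
lemma equivalent_cod_of_ne_zero {A B C a b c : ℂ⟦X⟧} {u v : ℂ⟦X⟧} (h : ℂ⟦X⟧)
    (hu : constantCoeff u ≠ 0) (hv : constantCoeff v ≠ 0) (hc : c ≠ 0)
    (hD : A * derivative ℂ C = B * C) (hd : a * derivative ℂ c = b * c)
    (E1 : u * A = a - h * c) (E2 : C = v * c) : Equivalent (cod A B C) (cod a b c) := by
  refine equivalent_cod_of_eq h hu hv E1 E2 (mul_right_cancel₀ hc ?_)
  have hC : derivative ℂ C = v * derivative ℂ c + c * derivative ℂ v := by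
    rw [E2, Derivation.leibniz]; simp
  linear_combination (-u) * hD + derivative ℂ C * E1 - u * B * E2 + a * hC + v * hd

/-- The case `c ≠ 0`. Scaling `η` turns `c` into `x^l`, and the `h θη` part of a change of
coordinates changes `a` by multiples of `x^l`. Either `a` can be made `0`, which gives `d_l^*`, or `a`
is `x^(k-1)` up to a unit with `k ≤ l`, which gives `d^♯_{k,l}`. -/
lemma exists_label_of_right_ne_zero {a b c : ℂ⟦X⟧} (hc0 : constantCoeff c = 0)
    (hd : a * derivative ℂ c = b * c) (hc : c ≠ 0) :
    ∃ N : Label, N.Valid ∧ ∀ d' ∈ N.codiffs, Equivalent (cod a b c) d' := by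
  obtain ⟨l, γ, rfl, hγ⟩ := exists_X_pow_mul hc
  have hl : l ≠ 0 := by rintro rfl; exact hγ (by simpa using hc0)
  by_cases hal : X ^ l ∣ a
  · obtain ⟨s, rfl⟩ := hal
    refine ⟨.star l, Nat.one_le_iff_ne_zero.2 hl, ?_⟩
    rintro d' rfl
    rw [dStar_eq]
    exact equivalent_cod_of_ne_zero (u := 1) (v := γ) (-s) (by simp) hγ (pow_ne_zero _ X_ne_zero)
      hd (by simp) (by ring) (by ring)
  · have ha : a ≠ 0 := by rintro rfl; exact hal (dvd_zero _)
    obtain ⟨p, α, rfl, hα⟩ := exists_X_pow_mul ha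
    have hpl : p < l := by
      by_contra! hle
      exact hal ((pow_dvd_pow _ hle).mul_right _)
    -- for `p = 0` the order of `a c'` would be `l - 1`, less than that of `b c`
    have hp : p ≠ 0 := by
      rintro rfl
      obtain ⟨m, rfl⟩ := Nat.exists_eq_succ_of_ne_zero hl
      have h1 := congr(coeff m $hd)
      have h2 : derivative ℂ (X ^ (m + 1) * γ) =
          X ^ m * (C (m + 1 : ℂ) * γ + X * derivative ℂ γ) := by
        simp; ring
      have h3 : b * (X ^ (m + 1) * γ) = X ^ (m + 1) * (b * γ) := by ring
      rw [h2, h3, coeff_X_pow_mul', if_neg (by omega), pow_zero, one_mul, mul_left_comm,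
        coeff_X_pow_mul', if_pos le_rfl] at h1
      have h4 : (m + 1 : ℂ) ≠ 0 := by exact_mod_cast m.succ_ne_zero
      simp [hα, hγ, h4] at h1
    refine ⟨.sharp (p + 1) l, ⟨by omega, hpl⟩, ?_⟩
    rintro d' rfl
    rw [dSharp_eq]
    refine equivalent_cod_of_ne_zero (u := α⁻¹) (v := γ) 0 (by simpa using hα) hγ
      (pow_ne_zero _ X_ne_zero) hd ?_ ?_ (by ring)
    · obtain ⟨p, rfl⟩ := Nat.exists_eq_succ_of_ne_zero hp
      obtain ⟨l, rfl⟩ := Nat.exists_eq_succ_of_ne_zero hl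
      simp [smul_eq_C_mul]; ring
    · simp only [zero_mul, sub_zero, Nat.add_sub_cancel]
      linear_combination X ^ p * PowerSeries.mul_inv_cancel α hα

/-- The case `a = c = 0` leads to `d_k(0 : 1)`. -/
lemma exists_label_of_left_eq_zero {b : ℂ⟦X⟧} (hb : b ≠ 0) :
    ∃ N : Label, N.Valid ∧ ∀ d' ∈ N.codiffs, Equivalent (cod 0 b 0) d' := by
  obtain ⟨q, β, rfl, hβ⟩ := exists_X_pow_mul hb
  obtain ⟨P, hP⟩ := hasCoords_mk (a := 0) (b := 1) (by simp)
  refine ⟨.line (q + 2) P, Or.inl (by omega), ?_⟩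
  rintro d' ⟨x, y, hxy, rfl⟩
  obtain ⟨r, hr, rfl, rfl⟩ := hP.exists_smul hxy
  rw [dLine_eq]
  refine equivalent_cod_of_eq (u := C r * β⁻¹) (v := 1) 0 (by simp [hr, hβ]) (by simp)
    (by simp) (by simp) ?_
  simp [smul_eq_C_mul]
  linear_combination C r * X ^ q * PowerSeries.mul_inv_cancel β hβ

/-- The case `c = 0` in which `b / a` has a pole of order at most one. Scaling `η` by `v` changes
`b / a` by the logarithmic derivative of `v`, so that only the residue of `b / a` remains; this gives
`d_k(1 : ρ)`. -/
lemma exists_label_of_dvd {p : ℕ} {α b : ℂ⟦X⟧} (hα : constantCoeff α ≠ 0) (hb : X ^ p ∣ X * b) :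
    ∃ N : Label, N.Valid ∧ ∀ d' ∈ N.codiffs, Equivalent (cod (X ^ p * α) b 0) d' := by
  obtain ⟨s', hs'⟩ := hb
  have iα := PowerSeries.mul_inv_cancel α hα
  -- `s = x b / a`, and its constant term `ρ` is the residue of `b / a`
  set s := α⁻¹ * s' with hs
  have hsb : X * b = X ^ p * α * s := by rw [hs']; linear_combination (- X ^ p * s') * iα
  set ρ := constantCoeff s with hρ
  obtain ⟨P, hP⟩ := hasCoords_mk (a := 1) (b := ρ) (by simp)
  -- for `p = 0` the codifferential has `k = 1`, where only the point `(1 : 0)` is allowed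
  have hp0 : p = 0 → ρ = 0 := by
    rintro rfl
    have := congr(constantCoeff $hsb)
    simpa [hα, ← hρ] using this
  obtain ⟨g, hg, -⟩ := eq_C_add_X_mul s
  obtain ⟨v, hv0, hv⟩ := exists_derivative_eq g
  refine ⟨.line (p + 1) P, ?_, ?_⟩
  · rcases p with _ | p
    · right; rw [← hp0 rfl]; exact ⟨rfl, hP⟩
    · left; omega
  · rintro d' ⟨x, y, hxy, rfl⟩
    obtain ⟨r, hr, rfl, rfl⟩ := hP.exists_smul hxy
    rw [dLine_eq]
    refine equivalent_cod_of_eq (u := C r * α⁻¹) (v := v) 0 (by simp [hr, hα]) (by simp [hv0])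
      ?_ (by simp) ?_
    · simp [smul_eq_C_mul]
      linear_combination C r * X ^ p * iα
    · apply mul_left_cancel₀ (X_ne_zero (R := ℂ))
      have hX : X * ((r * ρ) • X ^ (p + 1 - 2) : ℂ⟦X⟧) = C (r * ρ) * X ^ p := by
        rcases p with _ | p
        · simp [hp0 rfl]
        · simp [smul_eq_C_mul, pow_succ']; ring
      rw [← hρ] at hg
      rw [map_mul] at hX
      rw [hv, mul_one, smul_eq_C_mul, Nat.add_sub_cancel]
      linear_combination C r * α⁻¹ * v * hsb + C r * v * X ^ p * s * iα + C r * X ^ p * v * hg -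
        v * hX

/-- Up to forms without pole, a form with a pole of order `n + 1` becomes
`dx / (x^(n+1) (1 + α x^n))` after a substitution: if `w / x^n` is, up to a constant factor, the
primitive of the polar part without residue, then `φ` is an `n`-th root of `1 / w`. -/
lemma exists_residue_normal_form {n : ℕ} (hn : n ≠ 0) {t : ℂ⟦X⟧} (ht : constantCoeff t ≠ 0) :
    ∃ φ : ℂ⟦X⟧, ∃ α : ℂ, constantCoeff φ ≠ 0 ∧
      X ^ (n + 1) ∣ t * φ ^ (n + 1) * (1 + C α * X ^ n * φ ^ n) - (φ + X * derivative ℂ φ) := by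
  have hn' : (n : ℂ) ≠ 0 := by exact_mod_cast hn
  -- `n w - x w'` agrees with `n t` in degrees less than `n`
  set w : ℂ⟦X⟧ := PowerSeries.mk fun i => if i < n then coeff i t / (1 - i / n) else 0 with hw
  have hw0 : constantCoeff w = constantCoeff t := by
    rw [← coeff_zero_eq_constantCoeff_apply, hw, coeff_mk, if_pos (by omega)]; simp
  obtain ⟨φ, hφ⟩ := exists_pow_mul_eq_one hn (w := w) (by rwa [hw0])
  have hφ0' : constantCoeff φ ^ n * constantCoeff t = 1 := by
    simpa [hw0] using congr(constantCoeff $hφ)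
  have hφ0 : constantCoeff φ ≠ 0 := fun h0 => by simp [h0, hn] at hφ0'
  -- differentiate `φ ^ n * w = 1`
  have hdw : C (n : ℂ) * derivative ℂ φ * w + φ * derivative ℂ w = 0 := by
    have h1 := congr(derivative ℂ $hφ)
    rw [Derivation.leibniz, Derivation.leibniz_pow, derivative_one] at h1
    obtain ⟨m, rfl⟩ := Nat.exists_eq_succ_of_ne_zero hn
    have hφm : φ ^ m ≠ 0 := pow_ne_zero _ fun h0 => hφ0 (by simp [h0])
    apply mul_left_cancel₀ hφm
    have : ((m + 1 : ℕ) : ℂ⟦X⟧) = C ((m + 1 : ℕ) : ℂ) := by simp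
    simp only [smul_eq_mul, nsmul_eq_mul, Nat.succ_eq_add_one, Nat.add_sub_cancel, this] at h1
    simp only [Nat.succ_eq_add_one]
    linear_combination h1
  -- `n w - x w'` has no term of degree `n`, which forces `α`
  refine ⟨φ, - coeff n t, hφ0, ?_⟩
  set α := - coeff n t with hα
  have hdvd : X ^ (n + 1) ∣ C (n : ℂ) * t * (1 + C α * X ^ n * φ ^ n) -
      ((n : ℂ) • w - X * derivative ℂ w) := by
    rw [X_pow_dvd_iff]
    intro i hi
    have e : C (n : ℂ) * t * (1 + C α * X ^ n * φ ^ n) =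
        C (n : ℂ) * t + X ^ n * (C (n : ℂ) * C α * (φ ^ n * t)) := by ring
    rw [e, map_sub, map_add, coeff_X_pow_mul', hw]
    have h3 := coeff_sub_X_mul_derivative n w i
    rw [hw] at h3
    rw [h3, coeff_mk]
    rcases Nat.lt_succ_iff_lt_or_eq.1 hi with hlt | rfl
    · have : (n : ℂ) - i ≠ 0 := by
        rw [sub_ne_zero]; exact_mod_cast hlt.ne'
      rw [if_neg (by omega), if_pos hlt]
      simp only [coeff_C_mul]
      field_simp
      ring
    · rw [if_pos le_rfl, coeff_C_mul]
      simp [hφ0', hα]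
  obtain ⟨z, hz⟩ := hdvd
  refine ⟨C (n : ℂ)⁻¹ * φ ^ (n + 1) * z, ?_⟩
  have iN : C (n : ℂ)⁻¹ * C (n : ℂ) = (1 : ℂ⟦X⟧) := by rw [← map_mul, inv_mul_cancel₀ hn', map_one]
  rw [smul_eq_C_mul] at hz
  have key : C (n : ℂ) * (φ + X * derivative ℂ φ) =
      φ ^ (n + 1) * (C (n : ℂ) * w - X * derivative ℂ w) := by
    linear_combination (-C (n : ℂ) * φ - C (n : ℂ) * X * derivative ℂ φ) * hφ + X * φ ^ n * hdw
  linear_combination C (n : ℂ)⁻¹ * φ ^ (n + 1) * hz + C (n : ℂ)⁻¹ * (-1) * key +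
    (φ + X * derivative ℂ φ - t * φ ^ (n + 1) * (1 + C α * X ^ n * φ ^ n)) * iN

/-- The case `c = 0` in which `b / a` has a pole of order at least two leads to `d_{k,l}(α)`. -/
lemma exists_label_of_lt {p q : ℕ} {α β : ℂ⟦X⟧} (hα : constantCoeff α ≠ 0)
    (hβ : constantCoeff β ≠ 0) (hpq : q + 1 < p) :
    ∃ N : Label, N.Valid ∧ ∀ d' ∈ N.codiffs, Equivalent (cod (X ^ p * α) (X ^ q * β) 0) d' := by
  obtain ⟨n, hn, rfl⟩ : ∃ n, n ≠ 0 ∧ p = q + (n + 1) := ⟨p - q - 1, by omega, by omega⟩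
  have iα := PowerSeries.mul_inv_cancel α hα
  obtain ⟨φ, τ, hφ, z, hz⟩ := exists_residue_normal_form hn (t := β * α⁻¹) (by simp [hα, hβ])
  refine ⟨.pair (q + 2) (q + 2 + n) τ, ⟨by omega, by omega⟩, ?_⟩
  rintro d' rfl
  -- the coordinate change is applied to the normal form, as it involves substitution only there
  apply Equivalent.symm
  have i1 : q + 2 + n - 1 = q + (n + 1) := by omega
  have i2 : q + 2 + n - (q + 2) = n := by omega
  rw [dPair_eq, pair_series_eq (by omega), i1, i2, Nat.add_sub_cancel, equivalent_cod_iff]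
  set W := 1 + C τ * X ^ n * φ ^ n with hW
  have hW0 : constantCoeff W = 1 := by simp [hW, hn]
  have iφ := PowerSeries.mul_inv_cancel (φ ^ (q + (n + 1))) (by simp [hφ])
  have iW := PowerSeries.mul_inv_cancel W (by simp [hW0])
  set ω := φ + X * derivative ℂ φ with hω
  have hω0 : constantCoeff ω = constantCoeff φ := by simp [hω]
  set K := (φ ^ (q + (n + 1)))⁻¹ with hK
  set u := ω * α * K * W⁻¹ with hu
  -- `u φ^q - β` is divisible by `X^(n+1)`
  have hdiv : u * φ ^ q - β = X ^ (n + 1) * (- α * K * W⁻¹ * φ ^ q * z) := by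
    rw [hu]
    linear_combination (-α * K * W⁻¹ * φ ^ q) * hz + β * W * W⁻¹ * iφ + β * iW -
      (- K * W⁻¹ * φ ^ q * β * φ ^ (n + 1) * W) * iα
  obtain ⟨v, hv0, hv⟩ := exists_derivative_eq (- α * K * W⁻¹ * φ ^ q * z * α⁻¹)
  refine ⟨φ, u, v, 0, hφ, ?_, by simp [hv0], ?_, by simp, ?_⟩
  · simp [hu, hω0, hK, hφ, hα, hW0]
  · simp only [map_mul, map_pow, map_add, map_one, precomp_X, precomp_C, zero_mul, sub_zero,
      mul_pow, ← mul_assoc]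
    rw [← hW, hu]
    linear_combination X ^ (q + (n + 1)) * ω * α * (W * W⁻¹ * iφ + iW)
  · simp only [map_pow, precomp_X, mul_pow, zero_mul, zero_add]
    rw [hv]
    linear_combination v * X ^ q * hdiv - v * X ^ q * X ^ (n + 1) * (- α * K * W⁻¹ * φ ^ q * z) * iα

lemma IsCodifferential.exists_label {d : S →ₗ[ℂ] S} (hd : IsCodifferential d) (h0 : d ≠ 0) :
    ∃ N : Label, N.Valid ∧ ∀ d' ∈ N.codiffs, Equivalent d d' := by
  obtain ⟨a, b, c, hc0, habc, rfl⟩ := hd.exists_eq_cod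
  by_cases hc : c = 0
  · subst hc
    by_cases ha : a = 0
    · subst ha
      exact exists_label_of_left_eq_zero fun hb => h0 (by rw [hb, cod_zero])
    · obtain ⟨p, α, rfl, hα⟩ := exists_X_pow_mul ha
      by_cases hb : X ^ p ∣ X * b
      · exact exists_label_of_dvd hα hb
      · have hb0 : b ≠ 0 := by rintro rfl; simp at hb
        obtain ⟨q, β, rfl, hβ⟩ := exists_X_pow_mul hb0
        refine exists_label_of_lt hα hβ ?_
        by_contra! hle
        apply hb
        rw [← mul_assoc, ← pow_succ']
        exact (pow_dvd_pow _ hle).mul_right _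
  · exact exists_label_of_right_ne_zero hc0 habc hc

/-! ### Members of the list -/

lemma Equivalent.refl (d : S →ₗ[ℂ] S) : Equivalent d d :=
  ⟨CoalgEquiv.refl ℂ S, fun _ _ hx => hx, fun _ => rfl⟩

lemma HasLead.ne_zero {L : Label} {d : S →ₗ[ℂ] S} (h : HasLead L d) : d ≠ 0 := by
  obtain ⟨k, a, b, c, rfl, -, hL⟩ := h
  intro h0
  rw [← cod_zero, cod_eq_cod_iff] at h0
  obtain ⟨rfl, rfl, rfl⟩ := h0
  exact hL.ne_zero (by simp [weightCoeff])

/-- The relation `a c' = b c` for `d^♯_{k,l}`. -/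
lemma sharp_relation {k l : ℕ} (hk : 2 ≤ k) (hl : 1 ≤ l) :
    (X ^ (k - 1) : ℂ⟦X⟧) * derivative ℂ (X ^ l) = (l : ℂ) • X ^ (k - 2) * X ^ l := by
  obtain ⟨k, rfl⟩ : ∃ k', k = k' + 2 := ⟨k - 2, by omega⟩
  obtain ⟨l, rfl⟩ : ∃ l', l = l' + 1 := ⟨l - 1, by omega⟩
  simp [smul_eq_C_mul]; ring

lemma Label.Valid.isCodifferential {N : Label} (hN : N.Valid) {d : S →ₗ[ℂ] S}
    (hd : d ∈ N.codiffs) : IsCodifferential d := by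
  cases N with
  | line k P =>
    obtain ⟨a, b, -, rfl⟩ := hd
    rw [dLine_eq]
    exact isCodifferential_cod (map_zero _) (by simp)
  | star k =>
    obtain rfl : d = dStar k := hd
    rw [dStar_eq]
    exact isCodifferential_cod (by simp [Nat.one_le_iff_ne_zero.1 hN]) (by simp)
  | pair k l α =>
    obtain rfl : d = dPair k l α := hd
    rw [dPair_eq]
    exact isCodifferential_cod (map_zero _) (by simp)
  | sharp k l =>
    obtain rfl : d = dSharp k l := hd
    have hl : 1 ≤ l := le_trans (le_trans one_le_two hN.1) hN.2
    rw [dSharp_eq]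
    exact isCodifferential_cod (by simp [Nat.one_le_iff_ne_zero.1 hl]) (sharp_relation hN.1 hl)

lemma Label.Valid.ne_zero {N : Label} (hN : N.Valid) {d : S →ₗ[ℂ] S} (hd : d ∈ N.codiffs) :
    d ≠ 0 :=
  let ⟨_, _, h⟩ := hN.exists_lead hd
  h.ne_zero

lemma Label.codiffs_nonempty (N : Label) : ∃ d, d ∈ N.codiffs := by
  cases N with
  | line k P =>
    obtain ⟨a, b, h⟩ := exists_hasCoords P
    exact ⟨_, a, b, h, rfl⟩
  | star k => exact ⟨_, rfl⟩
  | pair k l α => exact ⟨_, rfl⟩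
  | sharp k l => exact ⟨_, rfl⟩

lemma Label.equivalent_of_mem {N : Label} {d d' : S →ₗ[ℂ] S} (hd : d ∈ N.codiffs)
    (hd' : d' ∈ N.codiffs) : Equivalent d d' := by
  cases N with
  | line k P =>
    obtain ⟨a, b, h, rfl⟩ := hd
    obtain ⟨a', b', h', rfl⟩ := hd'
    obtain ⟨r, hr, rfl, rfl⟩ := h.exists_smul h'
    have := linearlyEquivalent_cod_smul (a • X ^ (k - 1)) (b • X ^ (k - 2)) 0 hr one_ne_zero
    rw [dLine_eq, dLine_eq]
    simpa only [smul_smul, smul_zero] using this.equivalent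
  | star k => exact (show d = d' from hd.trans hd'.symm) ▸ Equivalent.refl d
  | pair k l α => exact (show d = d' from hd.trans hd'.symm) ▸ Equivalent.refl d
  | sharp k l => exact (show d = d' from hd.trans hd'.symm) ▸ Equivalent.refl d

lemma Label.eq_of_forall_equivalent {N N' : Label} (hN : N.Valid) (hN' : N'.Valid)
    {d : S →ₗ[ℂ] S} (h : ∀ d' ∈ N.codiffs, Equivalent d d')
    (h' : ∀ d' ∈ N'.codiffs, Equivalent d d') : N = N' := by
  obtain ⟨e, he⟩ := N.codiffs_nonempty
  obtain ⟨e', he'⟩ := N'.codiffs_nonempty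
  exact eq_of_equivalent hN hN' he he' ((h e he).symm.trans (h' e' he'))

/-! ### Codifferentials of fixed degree -/

lemma eq_C_mul_X_pow {p : ℂ⟦X⟧} {k : ℕ} (h : ∀ n, n ≠ k → coeff n p = 0) :
    p = C (coeff k p) * X ^ k := by
  ext n
  rw [coeff_C_mul, coeff_X_pow]
  split_ifs with hn
  · rw [hn, mul_one]
  · rw [h n hn, mul_zero]

/-- A codifferential of fixed degree has monomial coefficients `α x^(k-1)`, `β x^(k-2)`, `γ x^k`
with `γ (β - k α) = 0`, and rescaling `θ` and `η` normalizes them. -/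
lemma IsCodifferential.exists_label_of_isOfDegree {k : ℕ} {d : S →ₗ[ℂ] S}
    (hd : IsCodifferential d) (h0 : d ≠ 0) (hk : IsOfDegree k d) :
    ∃ N : Label, N.Valid ∧ N.FixedDegree k ∧ ∀ d' ∈ N.codiffs, LinearlyEquivalent d d' := by
  obtain ⟨a, b, c, hc0, habc, rfl⟩ := hd.exists_eq_cod
  rw [isOfDegree_cod_iff] at hk
  simp only [weightCoeff, Prod.mk_eq_zero] at hk
  have ha := eq_C_mul_X_pow fun n hn => (hk n hn).1
  have hb := eq_C_mul_X_pow fun n hn => (hk n hn).2.1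
  have hc := eq_C_mul_X_pow fun n hn => (hk n hn).2.2
  set α := coeff k (X * a) with hα
  set β := coeff k (X ^ 2 * b) with hβ
  set γ := coeff k c with hγ
  have hk1 : 1 ≤ k := by
    by_contra! h
    obtain rfl : k = 0 := by omega
    apply h0
    have e1 : α = 0 := by simp [hα]
    have e2 : β = 0 := by simp [hβ]
    have e3 : γ = 0 := by simpa [hγ] using hc0
    rw [e1, map_zero, zero_mul] at ha
    rw [e2, map_zero, zero_mul] at hb
    rw [e3, map_zero, zero_mul] at hc
    rw [(mul_eq_zero.1 ha).resolve_left X_ne_zero,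
      (mul_eq_zero.1 hb).resolve_left (pow_ne_zero _ X_ne_zero), hc, cod_zero]
  -- there is no cochain on `e₁^(k-2) e₂ e₃` for `k = 1`
  have hβ1 : k = 1 → β = 0 := by
    rintro rfl
    simp [hβ, pow_two, mul_assoc, coeff_succ_X_mul]
  have ha' : a = α • X ^ (k - 1) := by
    apply mul_left_cancel₀ (X_ne_zero (R := ℂ))
    rw [ha, ← X_mul_X_pow_pred hk1, smul_eq_C_mul]; ring
  have hb' : b = β • X ^ (k - 2) := by
    apply mul_left_cancel₀ (pow_ne_zero 2 (X_ne_zero (R := ℂ)))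
    rcases hk1.eq_or_lt with h1 | h2
    · rw [hb, hβ1 h1.symm]; simp
    · rw [hb, ← X_sq_mul_X_pow h2, smul_eq_C_mul]; ring
  have hc' : c = γ • X ^ k := by rw [hc, smul_eq_C_mul]
  clear_value α β γ
  subst ha' hb' hc'
  by_cases hγ0 : γ = 0
  · subst hγ0
    rw [zero_smul] at h0 ⊢
    have hne : α ≠ 0 ∨ β ≠ 0 := by
      by_contra! h
      exact h0 (by rw [h.1, h.2, zero_smul, zero_smul, cod_zero])
    obtain ⟨P, hP⟩ := hasCoords_mk hne
    refine ⟨.line k P, ?_, Or.inl ⟨P, rfl⟩, ?_⟩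
    · rcases hk1.eq_or_lt with h1 | h2
      · refine Or.inr ⟨h1.symm, ?_⟩
        have hβ0 := hβ1 h1.symm
        subst hβ0
        have hα0 : α ≠ 0 := by simpa using hne
        obtain ⟨P', hP'⟩ := hasCoords_mk (a := 1) (b := 0) (by simp)
        rwa [← hP'.eq_of_smul (P' := P) (r := α) (by simpa using hP)]
      · exact Or.inl h2
    · rintro d' ⟨x, y, hxy, rfl⟩
      obtain ⟨r, hr, rfl, rfl⟩ := hP.exists_smul hxy
      have := linearlyEquivalent_cod_smul (α • X ^ (k - 1)) (β • X ^ (k - 2)) 0 hr one_ne_zero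
      rw [dLine_eq]
      simpa only [smul_smul, smul_zero] using this
  · have hrel : β = k * α := by
      obtain ⟨m, rfl⟩ : ∃ m, k = m + 1 := ⟨k - 1, by omega⟩
      have e1 : X ^ 2 * (β • X ^ (m + 1 - 2)) = C β * (X ^ (m + 1) : ℂ⟦X⟧) := by
        rcases m with _ | m
        · rw [hβ1 rfl]; simp
        · simp [smul_eq_C_mul]; ring
      have e2 : X ^ 2 * (α • X ^ (m + 1 - 1) * derivative ℂ (γ • X ^ (m + 1))) =
          X ^ (m + 1 + (m + 1)) * C (((m + 1 : ℕ) : ℂ) * α * γ) := by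
        simp [smul_eq_C_mul]; ring
      have e3 : X ^ 2 * (β • X ^ (m + 1 - 2) * (γ • X ^ (m + 1))) =
          X ^ (m + 1 + (m + 1)) * C (β * γ) := by
        rw [← mul_assoc, e1, smul_eq_C_mul, map_mul, pow_add]; ring
      have e4 := mul_left_cancel₀ (pow_ne_zero _ X_ne_zero)
        (e2.symm.trans (congr(X ^ 2 * $habc).trans e3))
      have e5 := congr(constantCoeff $e4)
      rw [constantCoeff_C, constantCoeff_C] at e5
      exact (mul_right_cancel₀ hγ0 e5).symm
    subst hrel
    by_cases hα0 : α = 0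
    · subst hα0
      refine ⟨.star k, hk1, Or.inr (Or.inl rfl), ?_⟩
      rintro d' rfl
      have := linearlyEquivalent_cod_smul 0 0 (γ • X ^ k) (one_ne_zero (α := ℂ))
        (inv_ne_zero hγ0)
      rw [dStar_eq]
      simpa [smul_smul, inv_mul_cancel₀ hγ0] using this
    · refine ⟨.sharp k k, ⟨?_, le_rfl⟩, Or.inr (Or.inr rfl), ?_⟩
      · by_contra! h
        obtain rfl : k = 1 := by omega
        exact hα0 (by simpa using hβ1 rfl)
      · rintro d' rfl
        have := linearlyEquivalent_cod_smul (α • X ^ (k - 1)) ((k * α) • X ^ (k - 2)) (γ • X ^ k)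
          (inv_ne_zero hα0) (inv_ne_zero hγ0)
        rw [dSharp_eq]
        have e : α⁻¹ * (k * α) = k := by field_simp
        simpa only [smul_smul, inv_mul_cancel₀ hγ0, inv_mul_cancel₀ hα0, one_smul, e] using this

/-! ### Extensions -/

/-- An extension has the same component of lowest weight. -/
lemma HasLead.extends {k : ℕ} {N : Label} (hN : N.FixedDegree k) {d₀ d : S →ₗ[ℂ] S}
    (h : HasLead N d₀) (hd : IsCodifferential d) (he : Extends k d₀ d) : HasLead N d := by
  obtain ⟨n, a₀, b₀, c₀, rfl, hlow, hlead⟩ := h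
  obtain rfl : n = k := by
    rcases hN with ⟨P, rfl⟩ | rfl | rfl <;> exact hlead.1
  obtain ⟨a, b, c, -, -, rfl⟩ := hd.exists_eq_cod
  rw [extends_cod_iff] at he
  exact ⟨n, a, b, c, rfl, fun m hm => (he m hm.le).trans (hlow m hm), he n le_rfl ▸ hlead⟩

/-- After rescaling `θ`, `d_{k,l}(α)` extends `d_k(0 : r)`. -/
lemma Label.Valid.exists_extension_pair {k l : ℕ} {α : ℂ} {P : ℙ ℂ (Fin 2 → ℂ)}
    (hN' : (Label.pair k l α).Valid) (hP : HasCoords P 0 1) {d₀ : S →ₗ[ℂ] S}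
    (hd₀ : d₀ ∈ (Label.line k P).codiffs) :
    ∃ d, IsCodifferential d ∧ Extends k d₀ d ∧ Equivalent d (dPair k l α) := by
  obtain ⟨a, b, hab, rfl⟩ := hd₀
  obtain ⟨r, hr, rfl, rfl⟩ := hP.exists_smul hab
  obtain ⟨hk, hl⟩ := hN'
  refine ⟨cod (r • (X ^ (l - 1) + α • X ^ (2 * l - k - 1))) (r • X ^ (k - 2)) 0,
    isCodifferential_cod (map_zero _) (by simp), ?_, ?_⟩
  · rw [dLine_eq, extends_cod_iff]
    intro n hn
    have h1 : X ^ (k + 1) ∣ X * (r • (X ^ (l - 1) + α • X ^ (2 * l - k - 1)) : ℂ⟦X⟧) := by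
      rw [pair_series_eq hl, smul_eq_C_mul, mul_left_comm, ← mul_assoc X,
        X_mul_X_pow_pred (by omega)]
      exact ((pow_dvd_pow _ hl).mul_right _).mul_left _
    have h2 := X_pow_dvd_iff.1 h1 n (Nat.lt_succ_of_le hn)
    simp only [weightCoeff, Prod.mk.injEq]
    exact ⟨by rw [h2]; simp, by rw [mul_one], trivial⟩
  · have := linearlyEquivalent_cod_smul (X ^ (l - 1) + α • X ^ (2 * l - k - 1)) (X ^ (k - 2)) 0
      hr one_ne_zero
    rw [dPair_eq]
    simpa only [smul_zero] using this.equivalent.symm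

/-- After rescaling `θ`, `d^♯_{k,l}` extends `d_k(r : r l)`. -/
lemma Label.Valid.exists_extension_sharp {k l : ℕ} {P : ℙ ℂ (Fin 2 → ℂ)}
    (hN' : (Label.sharp k l).Valid) (hkl : k < l) (hP : HasCoords P 1 l) {d₀ : S →ₗ[ℂ] S}
    (hd₀ : d₀ ∈ (Label.line k P).codiffs) :
    ∃ d, IsCodifferential d ∧ Extends k d₀ d ∧ Equivalent d (dSharp k l) := by
  obtain ⟨a, b, hab, rfl⟩ := hd₀
  obtain ⟨r, hr, rfl, rfl⟩ := hP.exists_smul hab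
  refine ⟨cod (r • X ^ (k - 1)) (r • (l : ℂ) • X ^ (k - 2)) (X ^ l),
    isCodifferential_cod (by simp [show l ≠ 0 by omega]) ?_, ?_, ?_⟩
  · rw [smul_mul_assoc, smul_mul_assoc, sharp_relation hN'.1 (by omega)]
  · rw [dLine_eq, extends_cod_iff]
    intro n hn
    have h1 : coeff n (X ^ l : ℂ⟦X⟧) = 0 := by rw [coeff_X_pow, if_neg (by omega)]
    simp [weightCoeff, h1, mul_assoc]
  · have := linearlyEquivalent_cod_smul (X ^ (k - 1)) ((l : ℂ) • X ^ (k - 2)) (X ^ l)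
      hr one_ne_zero
    rw [dSharp_eq]
    simpa only [one_smul] using this.equivalent.symm

end LInf

theorem mainTheorem1 :
    -- every member of the list is a nonzero codifferential
    (∀ N : LInf.Label, N.Valid → ∀ d ∈ N.codiffs, LInf.IsCodifferential d ∧ d ≠ 0) ∧
    -- every nonzero codifferential is equivalent to exactly one member of the list
    (∀ d : LInf.S →ₗ[ℂ] LInf.S, LInf.IsCodifferential d → d ≠ 0 →
      ∃! N : LInf.Label, N.Valid ∧ ∀ d' ∈ N.codiffs, LInf.Equivalent d d') ∧
    -- classification of the codifferentials of fixed degree under linear equivalence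
    (∀ (k : ℕ) (d : LInf.S →ₗ[ℂ] LInf.S),
      LInf.IsCodifferential d → d ≠ 0 → LInf.IsOfDegree k d →
      ∃! N : LInf.Label, N.Valid ∧ N.FixedDegree k ∧
        ∀ d' ∈ N.codiffs, LInf.LinearlyEquivalent d d') ∧
    -- the classes of all extensions of the codifferentials of fixed degree
    (∀ (k : ℕ) (N : LInf.Label), N.Valid → N.FixedDegree k → ∀ d₀ ∈ N.codiffs,
      ∀ N' : LInf.Label, N'.Valid →
        ((∃ d : LInf.S →ₗ[ℂ] LInf.S, LInf.IsCodifferential d ∧ LInf.Extends k d₀ d ∧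
            ∀ d' ∈ N'.codiffs, LInf.Equivalent d d') ↔
          N' = N ∨
          (∃ P l α, LInf.HasCoords P 0 1 ∧ N = .line k P ∧ N' = .pair k l α) ∨
          (∃ P l, k < l ∧ LInf.HasCoords P 1 (l : ℂ) ∧ N = .line k P ∧ N' = .sharp k l))) := by

  refine ⟨fun N hN d hd => ⟨hN.isCodifferential hd, hN.ne_zero hd⟩, fun d hd h0 => ?_,
    fun k d hd h0 hk => ?_, fun k N hN hNk d₀ hd₀ N' hN' => ⟨?_, ?_⟩⟩
  · obtain ⟨N, hN, h⟩ := hd.exists_label h0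
    exact ⟨N, ⟨hN, h⟩, fun N' hN' => LInf.Label.eq_of_forall_equivalent hN'.1 hN hN'.2 h⟩
  · obtain ⟨N, hN, hNk, h⟩ := hd.exists_label_of_isOfDegree h0 hk
    exact ⟨N, ⟨hN, hNk, h⟩, fun N' hN' => LInf.Label.eq_of_forall_equivalent hN'.1 hN
      (fun d' hd' => (hN'.2.2 d' hd').equivalent) fun d' hd' => (h d' hd').equivalent⟩
  · rintro ⟨d, hd, hext, he⟩
    obtain ⟨L, hL, hLd⟩ := hN.exists_lead hd₀
    obtain rfl : L = N := by
      rcases hNk with ⟨P, rfl⟩ | rfl | rfl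
      · exact hL
      · exact hL
      · rcases hL with ⟨-, h⟩ | ⟨h, -⟩
        · exact h
        · exact absurd h (lt_irrefl k)
    obtain ⟨d', hd'⟩ := N'.codiffs_nonempty
    obtain ⟨L', hL', hLd'⟩ := hN'.exists_lead hd'
    obtain rfl := (hLd.extends hNk hd hext).eq hLd' (he d' hd')
    cases N' with
    | line k' P' => exact Or.inl hL'.symm
    | star k' => exact Or.inl hL'.symm
    | pair k' l α =>
      obtain ⟨P, hP, rfl⟩ := hL'
      rcases hNk with ⟨P', e⟩ | e | e <;> cases e
      exact Or.inr (Or.inl ⟨P, l, α, hP, rfl, rfl⟩)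
    | sharp k' l =>
      rcases hL' with ⟨rfl, rfl⟩ | ⟨hkl, P, hP, rfl⟩
      · exact Or.inl rfl
      · rcases hNk with ⟨P', e⟩ | e | e <;> cases e
        exact Or.inr (Or.inr ⟨P, l, hkl, hP, rfl, rfl⟩)
  · rintro (rfl | ⟨P, l, α, hP, rfl, rfl⟩ | ⟨P, l, hkl, hP, rfl, rfl⟩)
    · exact ⟨d₀, hN.isCodifferential hd₀, fun _ _ => rfl,
        fun d' hd' => LInf.Label.equivalent_of_mem hd₀ hd'⟩
    · obtain ⟨d, hd, hext, he⟩ := hN'.exists_extension_pair hP hd₀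
      exact ⟨d, hd, hext, by rintro d' rfl; exact he⟩
    · obtain ⟨d, hd, hext, he⟩ := hN'.exists_extension_sharp hkl hP hd₀
      exact ⟨d, hd, hext, by rintro d' rfl; exact he⟩
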